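/- Let $(M^2,g)$ be a surface with a smooth (possibly indefinite) metric whose algebra $\mathfrak p(g)$ of projective vector fields (fields whose local flow preserves the unparametrized geodesics) has dimension $3$. Let $(z,y)$ be normal coordinates on a connected open set $U$, i.e. coordinates with $z\neq 0$ in which the equation of the unparametrized geodesics is $$z^3\frac{d^2y}{dz^2}=\epsilon\left(\frac{dy}{dz}\right)^3,\qquad \epsilon\in\{1,-1\}.$$ To a point $X=[A:B:C:D]\in\mathbb{RP}^3$ associate the conic $Ay^2+2By+C+Dz^2=0$ in the $(z,y)$-plane, and let $\mathcal Q\subset\mathbb{RP}^3$ be the quadric $AC-B^2+\epsilon D^2=0$. (1) The geodesics are identified with points of $\mathcal Q$: a regular arc in $U$ is an unparametrized geodesic if and only if it lies on the conic of some $X\in\mathcal Q$; this $X$ is unique; and for every $X\in\mathcal Q$ and every point of $U$ on the conic of $X$ there is a geodesic arc through this point lying on that conic. (2) A geodesic 3-web on $U$ consists of three smooth foliations of $U$, pairwise transverse at every point, all of whose leaves are geodesics. It is hexagonal if near every point of $U$ there are smooth functions $u_1,u_2,u_3$ with nonvanishing differentials, constant along the leaves of the first, second and third foliation respectively, with $u_1+u_2+u_3\equiv0$.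 The dual focal curve of one of the foliations is the set of the points of $\mathcal Q$ that correspond by (1) to its leaves. Then a geodesic 3-web on $U$ is hexagonal if and only if one of its three dual focal curves lies on the conic $c_0=\mathcal Q\cap\{D=0\}$ and the other two lie on the section of $\mathcal Q$ by one common plane of $\mathbb{RP}^3$ different from the plane $D=0$. -/

import Mathlib

open scoped ContDiff LinearAlgebra.Projectivization

namespace GeodesicWeb

/-- The coordinate plane; a point `p` has the coordinates `z = p 0` and `y = p 1`. -/
abbrev Plane := Fin 2 → ℝ

/-- The partial derivative of a function on the plane with respect to the `i`-th coordinate. -/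
noncomputable def pd (i : Fin 2) (f : Plane → ℝ) (p : Plane) : ℝ :=
  fderiv ℝ f p (Pi.single i 1)

/-- `g` is (the coordinate matrix of) a smooth, possibly indefinite, metric on `U`. -/
structure IsMetricOn (g : Plane → Matrix (Fin 2) (Fin 2) ℝ) (U : Set Plane) : Prop where
  smooth : ∀ i j, ContDiffOn ℝ ∞ (fun p => g p i j) U
  symm : ∀ p ∈ U, (g p).IsSymm
  nondegenerate : ∀ p ∈ U, (g p).det ≠ 0

/-- The Christoffel symbol `Γ^i_{jk}` of the Levi-Civita connection of `g`. -/
noncomputable def christoffel (g : Plane → Matrix (Fin 2) (Fin 2) ℝ) (i j k : Fin 2)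
    (p : Plane) : ℝ :=
  1 / 2 * ∑ m, (g p)⁻¹ i m *
    (pd j (fun q => g q m k) p + pd k (fun q => g q m j) p - pd m (fun q => g q j k) p)

/-! ### The projective algebra -/

/-- The component `(L_V Γ)^i_{jk}` of the Lie derivative of the Levi-Civita connection of `g`
along the vector field `V`. -/
noncomputable def lieChristoffel (g : Plane → Matrix (Fin 2) (Fin 2) ℝ) (V : Plane → Plane)
    (i j k : Fin 2) (p : Plane) : ℝ :=
  pd j (pd k (fun q => V q i)) p + ∑ m,
    (V p m * pd m (christoffel g i j k) p
      - christoffel g m j k p * pd m (fun q => V q i) p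
      + christoffel g i m k p * pd j (fun q => V q m) p
      + christoffel g i j m p * pd k (fun q => V q m) p)

/-- `V` is a smooth projective vector field on `U`: its local flow preserves the geodesics of `g`
as unparametrized curves, that is, the Lie derivative of the connection is a symmetrized product
of the identity with a one-form `ψ`. -/
structure IsProjectiveField (g : Plane → Matrix (Fin 2) (Fin 2) ℝ) (U : Set Plane)
    (V : Plane → Plane) : Prop where
  smooth : ContDiffOn ℝ ∞ V U
  projective : ∀ p ∈ U, ∃ ψ : Fin 2 → ℝ, ∀ i j k, lieChristoffel g V i j k p =
    (if i = j then ψ k else 0) + (if i = k then ψ j else 0)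

theorem contDiffOn_coord {V : Plane → Plane} {U : Set Plane} (hV : ContDiffOn ℝ ∞ V U)
    (i : Fin 2) : ContDiffOn ℝ ∞ (fun q => V q i) U :=
  contDiffOn_pi.1 hV i

theorem differentiableAt_coord {V : Plane → Plane} {U : TopologicalSpace.Opens Plane}
    (hV : ContDiffOn ℝ ∞ V U) (i : Fin 2) {p : Plane} (hp : p ∈ U) :
    DifferentiableAt ℝ (fun q => V q i) p :=
  ((contDiffOn_coord hV i).differentiableOn (by simp)).differentiableAt (U.isOpen.mem_nhds hp)

theorem differentiableAt_pd {V : Plane → Plane} {U : TopologicalSpace.Opens Plane}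
    (hV : ContDiffOn ℝ ∞ V U) (i k : Fin 2) {p : Plane} (hp : p ∈ U) :
    DifferentiableAt ℝ (pd k (fun q => V q i)) p := by
  have h : ContDiffOn ℝ ∞ (fderiv ℝ (fun q => V q i)) U :=
    (contDiffOn_coord hV i).fderiv_of_isOpen U.isOpen (by simp)
  have h2 := (h.differentiableOn (by simp)).differentiableAt (U.isOpen.mem_nhds hp)
  exact h2.clm_apply (differentiableAt_const _)

theorem lieChristoffel_add (g : Plane → Matrix (Fin 2) (Fin 2) ℝ)
    {U : TopologicalSpace.Opens Plane} {V W : Plane → Plane} (hV : ContDiffOn ℝ ∞ V U)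
    (hW : ContDiffOn ℝ ∞ W U) (i j k : Fin 2) {p : Plane} (hp : p ∈ U) :
    lieChristoffel g (V + W) i j k p = lieChristoffel g V i j k p + lieChristoffel g W i j k p := by
  have h1 : ∀ (l m : Fin 2), ∀ q ∈ U,
      pd l (fun q => (V + W) q m) q = pd l (fun q => V q m) q + pd l (fun q => W q m) q := by
    intro l m q hq
    have := fderiv_fun_add (differentiableAt_coord hV m hq) (differentiableAt_coord hW m hq)
    simp only [pd, Pi.add_apply, this, add_apply]
  have h2 : pd j (pd k (fun q => (V + W) q i)) p
      = pd j (pd k (fun q => V q i)) p + pd j (pd k (fun q => W q i)) p := by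
    have he : pd k (fun q => (V + W) q i) =ᶠ[nhds p]
        (fun q => pd k (fun q => V q i) q + pd k (fun q => W q i) q) :=
      Filter.eventually_of_mem (U.isOpen.mem_nhds hp) (h1 k i)
    have := fderiv_fun_add (differentiableAt_pd hV i k hp) (differentiableAt_pd hW i k hp)
    rw [pd, he.fderiv_eq, this]
    rfl
  simp only [lieChristoffel, h2, h1 _ _ p hp, Fin.sum_univ_two]
  simp only [Pi.add_apply]
  ring

theorem lieChristoffel_smul (g : Plane → Matrix (Fin 2) (Fin 2) ℝ)
    {U : TopologicalSpace.Opens Plane} (r : ℝ) {V : Plane → Plane} (hV : ContDiffOn ℝ ∞ V U)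
    (i j k : Fin 2) {p : Plane} (hp : p ∈ U) :
    lieChristoffel g (r • V) i j k p = r * lieChristoffel g V i j k p := by
  have h1 : ∀ (l m : Fin 2), ∀ q ∈ U,
      pd l (fun q => (r • V) q m) q = r * pd l (fun q => V q m) q := by
    intro l m q hq
    have := fderiv_const_mul (differentiableAt_coord hV m hq) r
    simp only [pd, Pi.smul_apply, smul_eq_mul, this, smul_apply]
  have h2 : pd j (pd k (fun q => (r • V) q i)) p = r * pd j (pd k (fun q => V q i)) p := by
    have he : pd k (fun q => (r • V) q i) =ᶠ[nhds p] (fun q => r * pd k (fun q => V q i) q) :=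
      Filter.eventually_of_mem (U.isOpen.mem_nhds hp) (h1 k i)
    have := fderiv_const_mul (differentiableAt_pd hV i k hp) r
    rw [pd, he.fderiv_eq, this]
    rfl
  simp only [lieChristoffel, h2, h1 _ _ p hp, Fin.sum_univ_two]
  simp only [Pi.smul_apply, smul_eq_mul]
  ring

/-- The projective algebra of `g` on `U`, as a real vector space. A vector field on `U` is
represented by its extension by zero, so that two fields are equal as soon as they agree on `U`. -/
noncomputable def projectiveAlgebra (g : Plane → Matrix (Fin 2) (Fin 2) ℝ)
    (U : TopologicalSpace.Opens Plane) : Submodule ℝ (Plane → Plane) where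
  carrier := {V | IsProjectiveField g U V ∧ ∀ p ∉ U, V p = 0}
  zero_mem' := by
    refine ⟨⟨contDiffOn_const, fun p _ => ⟨0, fun i j k => ?_⟩⟩, fun _ _ => rfl⟩
    have h : ∀ (l m : Fin 2), pd l (fun q => (0 : Plane → Plane) q m) = fun _ => 0 := by
      intro l m
      funext q
      simp [pd]
    have h' : pd j (fun _ => (0 : ℝ)) p = 0 := by simp [pd]
    simp only [lieChristoffel, h, h']
    simp
  add_mem' := by
    rintro V W ⟨hV, hV0⟩ ⟨hW, hW0⟩
    refine ⟨⟨hV.smooth.add hW.smooth, fun p hp => ?_⟩, fun p hp => ?_⟩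
    · obtain ⟨ψ, hψ⟩ := hV.projective p hp
      obtain ⟨φ, hφ⟩ := hW.projective p hp
      refine ⟨ψ + φ, fun i j k => ?_⟩
      rw [lieChristoffel_add g hV.smooth hW.smooth i j k hp, hψ, hφ]
      split_ifs <;> simp <;> ring
    · simp [hV0 p hp, hW0 p hp]
  smul_mem' := by
    rintro r V ⟨hV, hV0⟩
    refine ⟨⟨hV.smooth.const_smul r, fun p hp => ?_⟩, fun p hp => ?_⟩
    · obtain ⟨ψ, hψ⟩ := hV.projective p hp
      refine ⟨r • ψ, fun i j k => ?_⟩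
      rw [lieChristoffel_smul g r hV.smooth i j k hp, hψ]
      split_ifs <;> simp <;> ring
    · simp [hV0 p hp]

/-! ### Geodesics and the normal coordinates -/

/-- The right-hand side of the equation `y'' = f (z, y, y')` of the unparametrized geodesics
of `g`, at the point `p = (z, y)` and the slope `s = y'`. -/
noncomputable def geodesicRHS (g : Plane → Matrix (Fin 2) (Fin 2) ℝ) (p : Plane) (s : ℝ) : ℝ :=
  -christoffel g 1 0 0 p + (christoffel g 0 0 0 p - 2 * christoffel g 1 0 1 p) * s
    - (christoffel g 1 1 1 p - 2 * christoffel g 0 0 1 p) * s ^ 2 + christoffel g 0 1 1 p * s ^ 3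

/-- In the coordinates `(z, y)` on `U` the equation of the unparametrized geodesics of `g` is
`z ^ 3 * y'' = ε * (y') ^ 3`, and `z` does not vanish on `U`. -/
structure IsNormalCoordinates (g : Plane → Matrix (Fin 2) (Fin 2) ℝ) (U : Set Plane) (ε : ℝ) :
    Prop where
  ne_zero : ∀ p ∈ U, p 0 ≠ 0
  equation : ∀ p ∈ U, ∀ s : ℝ, p 0 ^ 3 * geodesicRHS g p s = ε * s ^ 3

/-- `c`, restricted to the nonempty open interval `(a, b)`, is a regular parametrized arc in `U`. -/
structure IsRegularArc (U : Set Plane) (a b : ℝ) (c : ℝ → Plane) : Prop where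
  lt : a < b
  contDiffOn : ContDiffOn ℝ 2 c (Set.Ioo a b)
  mem : ∀ t ∈ Set.Ioo a b, c t ∈ U
  deriv_ne_zero : ∀ t ∈ Set.Ioo a b, deriv c t ≠ 0

/-- The arc is an unparametrized geodesic of `g`: its covariant acceleration is everywhere
proportional to its velocity. -/
def IsGeodesicArc (g : Plane → Matrix (Fin 2) (Fin 2) ℝ) (a b : ℝ) (c : ℝ → Plane) : Prop :=
  ∀ t ∈ Set.Ioo a b, ∃ r : ℝ, ∀ i,
    deriv (deriv c) t i + ∑ j, ∑ k, christoffel g i j k (c t) * deriv c t j * deriv c t k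
      = r * deriv c t i

/-! ### Geodesic 3-webs -/

/-- A smooth foliation by curves of `U`, given by its field of tangent lines: locally `L` is
spanned by a smooth vector field without zeros. -/
def IsFoliationOn (L : Plane → Submodule ℝ Plane) (U : Set Plane) : Prop :=
  ∀ p ∈ U, ∃ W : Set Plane, IsOpen W ∧ p ∈ W ∧ W ⊆ U ∧ ∃ X : Plane → Plane,
    ContDiffOn ℝ ∞ X W ∧ ∀ q ∈ W, X q ≠ 0 ∧ L q = Submodule.span ℝ {X q}

/-- The arc is an arc of a leaf of the foliation of `U` with the tangent line field `L`. -/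
structure IsLeafArc (L : Plane → Submodule ℝ Plane) (U : Set Plane) (a b : ℝ) (c : ℝ → Plane) :
    Prop where
  regular : IsRegularArc U a b c
  tangent : ∀ t ∈ Set.Ioo a b, deriv c t ∈ L (c t)

/-- Three pairwise transverse foliations of `U` all of whose leaves are geodesics of `g`. -/
structure IsGeodesicThreeWeb (g : Plane → Matrix (Fin 2) (Fin 2) ℝ) (U : Set Plane)
    (L : Fin 3 → Plane → Submodule ℝ Plane) : Prop where
  foliation : ∀ i, IsFoliationOn (L i) U
  transverse : ∀ p ∈ U, ∀ i j, i ≠ j → L i p ≠ L j p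
  geodesic : ∀ i a b c, IsLeafArc (L i) U a b c → IsGeodesicArc g a b c

/-- The 3-web is hexagonal: locally there are smooth functions `u 0, u 1, u 2` with nonvanishing
differentials, constant along the leaves of the respective foliations, whose sum vanishes. In other
words, the web is locally diffeomorphic to three families of parallel straight lines. -/
def IsHexagonal (U : Set Plane) (L : Fin 3 → Plane → Submodule ℝ Plane) : Prop :=
  ∀ p ∈ U, ∃ W : Set Plane, IsOpen W ∧ p ∈ W ∧ W ⊆ U ∧ ∃ u : Fin 3 → Plane → ℝ,
    (∀ i, ContDiffOn ℝ ∞ (u i) W) ∧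
    (∀ i, ∀ q ∈ W, fderiv ℝ (u i) q ≠ 0 ∧ ∀ v ∈ L i q, fderiv ℝ (u i) q v = 0) ∧
    ∀ q ∈ W, u 0 q + u 1 q + u 2 q = 0

/-! ### The dual space -/

/-- The real projective space `ℝP³` with the homogeneous coordinates `[A : B : C : D]`. -/
abbrev RP3 := ℙ ℝ (Fin 4 → ℝ)

/-- The quadric `A C - B ^ 2 + ε D ^ 2 = 0`. -/
def quadric (ε : ℝ) : Set RP3 :=
  {X | X.rep 0 * X.rep 2 - X.rep 1 ^ 2 + ε * X.rep 3 ^ 2 = 0}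

/-- The plane in `ℝP³` with the (dual) homogeneous coordinates `H`. -/
def plane (H : RP3) : Set RP3 :=
  {X | ∑ i, H.rep i * X.rep i = 0}

/-- The dual coordinates of the plane `D = 0`. -/
noncomputable def planeD : RP3 :=
  Projectivization.mk ℝ ![0, 0, 0, 1] fun h => one_ne_zero (congrFun h 3)

/-- The conic `c₀`, the section of the quadric by the plane `D = 0`. -/
def baseConic (ε : ℝ) : Set RP3 := quadric ε ∩ plane planeD

/-- The conic `A y ^ 2 + 2 B y + C + D z ^ 2 = 0` in the `(z, y)`-plane represented by a point
of `ℝP³`. -/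
def conic (X : RP3) : Set Plane :=
  {p | X.rep 0 * p 1 ^ 2 + 2 * X.rep 1 * p 1 + X.rep 2 + X.rep 3 * p 0 ^ 2 = 0}

/-- The dual focal curve of a foliation of `U`: the points of the quadric that represent
the conics carrying the leaves. -/
def focalCurve (ε : ℝ) (U : Set Plane) (L : Plane → Submodule ℝ Plane) : Set RP3 :=
  {X | X ∈ quadric ε ∧ ∃ a b c, IsLeafArc L U a b c ∧ ∀ t ∈ Set.Ioo a b, c t ∈ conic X}

end GeodesicWeb

namespace GeodesicWeb

open TopologicalSpace (Opens)

/-! ### Differential algebra of geodesic webs -/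

section Algebra

variable {R : Type*} [CommRing R] [Algebra ℝ R] {dz dy : Derivation ℝ R R}

/-! Take y as independent variable. The geodesics that are not horizontal (y not constant) solve z''
= -ε/z³, and with s = dz/dy the functions E = s² - ε/z², zs - Ey, z² + Ey² - 2zsy are constant along
them. Together with the constant -1 they are, up to the factor z², the vector `contact`. Hence this
vector labels the geodesic by a point of the quadric, the horizontal geodesics are the points with D
= 0, and a plane of ℝP³ is the zero locus of a quadratic first integral. Part (1) follows: `contact`
keeps its direction along geodesics (`contact_const`), and a conic of the quadric is recovered from
a point and its tangent there (`exists_eq_smul_contact`).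

For part (2), the slope p = dz/dy of a geodesic foliation satisfies p_y + p p_z = -ε/z³
(`pd_slope`). Hexagonality forces the sum S of the finite slopes to satisfy S_zz = 0
(`dz_dz_add_add`, `dz_dz_add`). Then, for λ(y) with λ'/λ = S_z, the polynomial λ ∏ (s - pᵢ) is a
first integral of z'' = -ε/z³; its coefficients are found successively by integration in z, and the
last equation is a compatibility condition. For three finite slopes this condition contains a term
in z⁻⁵ that nothing cancels (`not_dz_dz_add_add`), so some foliation is horizontal at each point,
and by connectedness the same one everywhere (`IsHexagonal.exists_horizontal`). For two finite
slopes p, q the integral is quadratic and its constant coefficients are those of a plane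
(`exists_plane_of_dz_dz_add`, `IsHexagonal.exists_plane`).

Conversely, a plane gives p + q = z Q'/Q, where Q(y) is the leading coefficient of its quadratic
polynomial in s. With F = 1/(Q(p - q)) the forms F(dz - p dy) and F(dz - q dy) are closed, and their
difference is a multiple of dy; primitives give the functions of a hexagonal web
(`isHexagonal_of_plane`).

All identities are checked in a commutative ring with two commuting derivations ∂z, ∂y, later
specialized to smooth functions on an open set. -/

theorem natCast_mul_cancel {n : ℕ} (hn : n ≠ 0) {x : R} (h : (n : R) * x = 0) : x = 0 := by
  have h1 : algebraMap ℝ R ((n : ℝ)⁻¹) * (n : R) = 1 := by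
    rw [← map_natCast (algebraMap ℝ R) n, ← map_mul, inv_mul_cancel₀ (Nat.cast_ne_zero.2 hn),
      map_one]
  calc x = algebraMap ℝ R ((n : ℝ)⁻¹) * (n : R) * x := by rw [h1, one_mul]
    _ = 0 := by rw [mul_assoc, h, mul_zero]

/-- Powers of a coordinate are linearly independent over the constants. -/
theorem coeff_eq_zero {z : R} (hz : dz z = 1) (n : ℕ) : ∀ c : ℕ → R, (∀ j, dz (c j) = 0) →
    ∑ j ∈ Finset.range n, c j * z ^ j = 0 → ∀ j < n, c j = 0 := by
  induction n with
  | zero => intro c _ _ j hj; omega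
  | succ n ih =>
    intro c hc h
    -- Applying dz removes the constant term and lowers the degree, so the induction hypothesis
    -- applies to the coefficients (j + 1) c (j + 1).
    have h1 : ∑ j ∈ Finset.range n, ((j + 1 : ℕ) * c (j + 1)) * z ^ j = 0 := by
      have := congrArg dz h
      rw [Finset.sum_range_succ'] at this
      simp only [map_add, map_sum, Derivation.leibniz, hc, smul_eq_mul, mul_zero, add_zero,
        Derivation.leibniz_pow, hz, map_zero, Nat.add_sub_cancel, pow_zero] at this
      refine Eq.trans ?_ this
      simp only [Derivation.map_one_eq_zero, mul_zero, add_zero]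
      refine Finset.sum_congr rfl fun j _ => ?_
      simp
      ring
    have h2 := ih (fun j => (j + 1 : ℕ) * c (j + 1))
      (fun j => by simp [Derivation.leibniz, hc]) h1
    have h3 : ∀ j < n, c (j + 1) = 0 := fun j hj => natCast_mul_cancel (by omega) (h2 j hj)
    have h4 : ∑ j ∈ Finset.range n, c (j + 1) * z ^ (j + 1) = 0 :=
      Finset.sum_eq_zero fun j hj => mul_eq_zero_of_left (h3 j (Finset.mem_range.1 hj)) _
    rw [Finset.sum_range_succ', h4] at h
    rintro (_ | j) hj
    · simpa using h
    · exact h3 j (by omega)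

/-- Equality of the mixed derivatives of G. Here S is the sum of the slopes and G a product that
vanishes nowhere in the application. -/
theorem mul_dz_dz_eq_zero (hcomm : ∀ f, dz (dy f) = dy (dz f)) {G S : R} (h0 : dz G = 0)
    (h1 : dy G = -(dz S * G)) : dz (dz S) * G = 0 := by
  have h := hcomm G
  rw [h0, h1, map_zero, map_neg, Derivation.leibniz, h0] at h
  simp only [smul_eq_mul] at h
  linear_combination -h

/-- The hexagonality condition for three geodesic foliations with finite slopes. -/
theorem dz_dz_add_add (hcomm : ∀ f, dz (dy f) = dy (dz f)) {φ p q r a b c : R}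
    (hp : dy p = φ - p * dz p) (hq : dy q = φ - q * dz q) (hr : dy r = φ - r * dz r)
    (h0 : a + b + c = 0) (h1 : p * a + q * b + r * c = 0)
    (ha : dy a = -dz (p * a)) (hb : dy b = -dz (q * b)) (hc : dy c = -dz (r * c)) :
    dz (dz (p + q + r)) * (a * (p - q) * (r - p)) = 0 := by
  have e0 := congrArg dz h0
  have e1 := congrArg dz h1
  have e2 := congrArg dy h1
  simp only [map_add, map_zero, Derivation.leibniz, smul_eq_mul, hp, hq, hr, ha, hb, hc]
    at e0 e1 e2
  simp only [Derivation.leibniz, smul_eq_mul] at ha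
  have f2 : b * (q - r) = a * (r - p) := by linear_combination h1 - r * h0
  have f3 : c * (q - r) = a * (p - q) := by linear_combination -h1 + q * h0
  -- By the two linear relations, a(p - q)(r - p) = -(p²a + q²b + r²c). The y-derivative of pa + qb
  -- + rc is φ(a + b + c) minus the z-derivative of p²a + q²b + r²c, whence the latter vanishes.
  have g0 : dz (a * (p - q) * (r - p)) = 0 := by
    simp only [Derivation.leibniz, smul_eq_mul, map_sub]
    linear_combination e2 - φ * h0 + (q + r) * e1 - q * r * e0 + dz q * f2 - dz r * f3
  refine mul_dz_dz_eq_zero hcomm g0 ?_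
  simp only [Derivation.leibniz, smul_eq_mul, map_sub, map_add] at g0 ⊢
  rw [hp, hq, hr, ha]
  -- Under dy + p dz, differentiation along the first foliation, the factors a, p - q, r - p are
  -- multiplied by -dz p, -dz q, -dz r.
  linear_combination -p * g0

/-- The hexagonality condition for two geodesic foliations with finite slopes and the horizontal
one. -/
theorem dz_dz_add (hcomm : ∀ f, dz (dy f) = dy (dz f)) {φ p q a : R}
    (hp : dy p = φ - p * dz p) (hq : dy q = φ - q * dz q)
    (ha : dy a = -dz (p * a)) (hb : dy a = -dz (q * a)) :
    dz (dz (p + q)) * (a * (p - q)) = 0 := by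
  simp only [Derivation.leibniz, smul_eq_mul] at ha hb
  have g0 : dz (a * (p - q)) = 0 := by
    simp only [Derivation.leibniz, smul_eq_mul, map_sub]
    linear_combination ha - hb
  refine mul_dz_dz_eq_zero hcomm g0 ?_
  simp only [Derivation.leibniz, smul_eq_mul, map_sub, map_add] at g0 ⊢
  rw [hp, hq, ha]
  linear_combination -p * g0

/-! ### Polynomial first integrals of degree three and two in the slope. -/

theorem dz_inv {z w : R} (hz : dz z = 1) (hw : w * z = 1) : dz w = -w ^ 2 := by
  have h := congrArg dz hw
  simp only [Derivation.leibniz, smul_eq_mul, hz, Derivation.map_one_eq_zero] at h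
  linear_combination w * h - dz w * hw

theorem dy_inv {z w : R} (hz : dy z = 0) (hw : w * z = 1) : dy w = 0 := by
  have h := congrArg dy hw
  simp only [Derivation.leibniz, smul_eq_mul, hz, Derivation.map_one_eq_zero] at h
  linear_combination w * h - dy w * hw

theorem dz_dy_add_mul (hcomm : ∀ f, dz (dy f) = dy (dz f)) {k f : R} (hk : dz k = 0)
    (hf : dz f = 0) : dz (dy f + k * f) = 0 := by
  rw [map_add, Derivation.leibniz, hcomm, hf, hk]; simp

/-- There is no cubic first integral without horizontal component. -/
theorem not_dz_dz_add_add [Nontrivial R] (hcomm : ∀ f, dz (dy f) = dy (dz f)) {z w ε p q r : R}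
    (hz : dz z = 1) (hzy : dy z = 0) (hw : w * z = 1) (hε : ε ^ 2 = 1) (hεz : dz ε = 0)
    (hεy : dy ε = 0)
    (hp : dy p = -ε * w ^ 3 - p * dz p) (hq : dy q = -ε * w ^ 3 - q * dz q)
    (hr : dy r = -ε * w ^ 3 - r * dz r) : dz (dz (p + q + r)) ≠ 0 := by
  intro hS
  have hwz := dz_inv hz hw
  have hwy := dy_inv hzy hw
  obtain ⟨η, hη, hηz, hηy⟩ : ∃ η : R, 6 * η = 1 ∧ dz η = 0 ∧ dy η = 0 :=
    ⟨algebraMap ℝ R (1 / 6), by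
      rw [← map_ofNat (algebraMap ℝ R) 6, ← map_mul]; norm_num,
      dz.map_algebraMap _, dy.map_algebraMap _⟩
  have n3 : dz (3 : R) = 0 := by exact_mod_cast dz.map_natCast 3
  have n3y : dy (3 : R) = 0 := by exact_mod_cast dy.map_natCast 3
  obtain ⟨k, hk⟩ : ∃ k, k = dz (p + q + r) := ⟨_, rfl⟩
  have hkz : dz k = 0 := by rw [hk, hS]
  obtain ⟨l, hl⟩ : ∃ l, l = p + q + r - z * k := ⟨_, rfl⟩
  have hlz : dz l = 0 := by
    rw [hl, map_sub, ← hk, Derivation.leibniz, hkz, hz, smul_eq_mul, smul_eq_mul]; ring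
  -- Write D f = dy f + k f, which is λ⁻¹ dy (λ f) when dy λ = k λ. With φ = -ε w³, the symmetric
  -- functions e₁, e₂, e₃ of the slopes satisfy dz e₂ = D e₁ - 3φ, dz e₃ = D e₂ - 2φ e₁ and D e₃ = φ
  -- e₂. The first two are integrated below, with h and j as constants of integration; η = 1/6
  -- supplies the denominators.
  obtain ⟨k1, hk1⟩ : ∃ k1, k1 = dy k + k * k := ⟨_, rfl⟩
  obtain ⟨l1, hl1⟩ : ∃ l1, l1 = dy l + k * l := ⟨_, rfl⟩
  have hk1z : dz k1 = 0 := hk1 ▸ dz_dy_add_mul hcomm hkz hkz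
  have hl1z : dz l1 = 0 := hl1 ▸ dz_dy_add_mul hcomm hkz hlz
  obtain ⟨k2, hk2⟩ : ∃ k1', k1' = dy k1 + k * k1 := ⟨_, rfl⟩
  obtain ⟨l2, hl2⟩ : ∃ l1', l1' = dy l1 + k * l1 := ⟨_, rfl⟩
  have hk2z : dz k2 = 0 := hk2 ▸ dz_dy_add_mul hcomm hkz hk1z
  have hl2z : dz l2 = 0 := hl2 ▸ dz_dy_add_mul hcomm hkz hl1z
  have hk3z := dz_dy_add_mul hcomm hkz hk2z
  have hl3z := dz_dy_add_mul hcomm hkz hl2z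
  have e1 : p + q + r = z * k + l := by rw [hl]; ring
  have e1y : dy p + dy q + dy r + k * (p + q + r) = z * k1 + l1 := by
    have := congrArg dy e1
    simp only [map_add, Derivation.leibniz, smul_eq_mul, hzy] at this
    rw [hk1, hl1, this, e1]; ring
  have hk' : k = dz p + dz q + dz r := by rw [hk, map_add, map_add]
  -- the second symmetric function of the slopes
  obtain ⟨h, hh⟩ : ∃ h, h = p * q + q * r + r * p
    - (3 * η * z ^ 2 * k1 + z * l1 - 9 * η * ε * w ^ 2) := ⟨_, rfl⟩
  have hhz : dz h = 0 := by
    rw [hh]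
    simp only [map_sub, map_add, Derivation.leibniz, Derivation.leibniz_pow, smul_eq_mul,
      nsmul_eq_mul, hηz, hk1z, hl1z, hz, hwz, hεz, n3, show (9 : R) = 3 * 3 by norm_num]
    rw [hp, hq, hr, hk'] at e1y
    push_cast
    linear_combination e1y - (3 * ε * w ^ 3 + z * k1) * hη
  have e2 : p * q + q * r + r * p
      = h + 3 * η * z ^ 2 * k1 + z * l1 - 9 * η * ε * w ^ 2 := by rw [hh]; ring
  obtain ⟨h1, hh1⟩ : ∃ h1, h1 = dy h + k * h := ⟨_, rfl⟩
  obtain ⟨h2, hh2⟩ : ∃ h2, h2 = dy h1 + k * h1 := ⟨_, rfl⟩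
  have hh1z : dz h1 = 0 := hh1 ▸ dz_dy_add_mul hcomm hkz hhz
  have hh2z : dz h2 = 0 := hh2 ▸ dz_dy_add_mul hcomm hkz hh1z
  have e2y : dy (p * q + q * r + r * p) + k * (p * q + q * r + r * p)
      = h1 + 3 * η * z ^ 2 * k2 + z * l2 - 9 * η * ε * k * w ^ 2 := by
    rw [e2]
    simp only [map_sub, map_add, Derivation.leibniz, Derivation.leibniz_pow, smul_eq_mul,
      nsmul_eq_mul, hηy, hzy, hwy, hεy, n3y, show (9 : R) = 3 * 3 by norm_num]
    rw [hh1, hk2, hl2]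
    ring
  -- the third symmetric function of the slopes
  obtain ⟨j, hj⟩ : ∃ j, j = p * q * r - (η * z ^ 3 * k2 + 3 * η * z ^ 2 * l2
    - 3 * η * ε * k * w + z * h1 - ε * l * w ^ 2) := ⟨_, rfl⟩
  have hjz : dz j = 0 := by
    rw [hj]
    simp only [map_sub, map_add, Derivation.leibniz, Derivation.leibniz_pow, smul_eq_mul,
      nsmul_eq_mul, hηz, hk2z, hl2z, hh1z, hlz, hkz, hz, hwz, hεz, n3]
    simp only [map_add, Derivation.leibniz, smul_eq_mul, hp, hq, hr] at e2y
    rw [hk'] at e2y ⊢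
    rw [hk'] at e1
    push_cast
    linear_combination e2y + 2 * ε * w ^ 3 * e1 + 2 * ε * (dz p + dz q + dz r) * w ^ 2 * hw
      - (2 * ε * (dz p + dz q + dz r) * w ^ 2 + z * l2) * hη
  have e3 : p * q * r = j + η * z ^ 3 * k2 + 3 * η * z ^ 2 * l2
    - 3 * η * ε * k * w + z * h1 - ε * l * w ^ 2 := by rw [hj]; ring
  have e3y : dy (p * q * r) + k * (p * q * r) = -ε * w ^ 3 * (p * q + q * r + r * p) := by
    simp only [Derivation.leibniz, smul_eq_mul, hp, hq, hr]
    rw [hk']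
    ring
  have hj1z := dz_dy_add_mul hcomm hkz hjz
  rw [e2, e3] at e3y
  simp only [map_sub, map_add, Derivation.leibniz, Derivation.leibniz_pow, smul_eq_mul,
      nsmul_eq_mul, hηy, hzy, hwy, hεy, n3y] at e3y
  -- These are the coefficients of zⁿ in z⁵ (D e₃ - φ e₂); the omitted ones cancel. The constant
  -- one, -9η = -3/2, comes from the term -9ηε w² of e₂ alone and gives the contradiction.
  let c : ℕ → R := fun n => match n with
    | 0 => -9 * η
    | 2 => ε * h
    | 5 => dy j + k * j
    | 6 => h2
    | 7 => 3 * η * (dy l2 + k * l2)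
    | 8 => η * (dy k2 + k * k2)
    | _ => 0
  have hcz : ∀ n, dz (c n) = 0 := by
    intro n
    simp only [c]
    split <;> simp only [Derivation.leibniz, map_neg, map_zero, neg_mul, hηz, hεz, hhz, hj1z, hh2z,
      hl3z, hk3z, n3, show (9 : R) = 3 * 3 by norm_num, smul_zero, add_zero, neg_zero]
  have w1 : z ^ 5 * w = z ^ 4 := by linear_combination z ^ 4 * hw
  have w2 : z ^ 5 * w ^ 2 = z ^ 3 := by linear_combination (z ^ 3 * (w * z) + z ^ 3) * hw
  have w3 : z ^ 5 * w ^ 3 = z ^ 2 := by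
    linear_combination z ^ 2 * ((w * z) ^ 2 + w * z + 1) * hw
  have w5 : z ^ 5 * w ^ 5 = 1 := by
    linear_combination ((w * z) ^ 4 + (w * z) ^ 3 + (w * z) ^ 2 + w * z + 1) * hw
  have h0 := coeff_eq_zero hz 9 c hcz (by
    simp only [Finset.sum_range_succ, Finset.sum_range_zero, c]
    linear_combination z ^ 5 * e3y + 3 * η * ε * k1 * w1 + ε * l1 * w2 - ε * h * w3
      - 3 * η * ε * k1 * z ^ 2 * w3 - ε * l1 * z * w3 + 9 * η * ε ^ 2 * w5 + 9 * η * hε + z ^ 6 * hh2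
      - 3 * η * ε * z ^ 5 * w * hk1 - ε * z ^ 5 * w ^ 2 * hl1) 0 (by norm_num)
  have h9 : (9 : R) * η = 0 := by simpa [c] using h0
  have h1 : (1 : R) = 0 := by
    have : ((3 : ℕ) : R) * 1 = 0 := by push_cast; linear_combination 2 * h9 - 3 * hη
    exact natCast_mul_cancel (by norm_num) this
  exact one_ne_zero h1

/-- Two families of geodesics whose slopes have a sum linear in `z` are cut out by a plane. -/
theorem exists_plane_of_dz_dz_add (hcomm : ∀ f, dz (dy f) = dy (dz f)) {z y w ε p q : R}
    (hz : dz z = 1) (hzy : dy z = 0) (hyz : dz y = 0) (hy : dy y = 1) (hw : w * z = 1)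
    (hε : ε ^ 2 = 1) (hεz : dz ε = 0) (hεy : dy ε = 0)
    (hp : dy p = -ε * w ^ 3 - p * dz p) (hq : dy q = -ε * w ^ 3 - q * dz q)
    (hS : dz (dz (p + q)) = 0) :
    ∃ k α β γ δ : R, (dz α = 0 ∧ dz β = 0 ∧ dz γ = 0 ∧ dz δ = 0) ∧
      (dy α = -k * α ∧ dy β = -k * β ∧ dy γ = -k * γ ∧ dy δ = -k * δ) ∧
      α - β * y + γ * y ^ 2 = 1 ∧ p + q = (-β + 2 * γ * y) * z ∧
      p * q = γ * z ^ 2 - ε * w ^ 2 - δ := by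
  have hwz := dz_inv hz hw
  have hwy := dy_inv hzy hw
  obtain ⟨η, hη, hηz, hηy⟩ : ∃ η : R, 2 * η = 1 ∧ dz η = 0 ∧ dy η = 0 :=
    ⟨algebraMap ℝ R (1 / 2), by
      rw [← map_ofNat (algebraMap ℝ R) 2, ← map_mul]; norm_num,
      dz.map_algebraMap _, dy.map_algebraMap _⟩
  have n2 : dz (2 : R) = 0 := by exact_mod_cast dz.map_natCast 2
  have n2y : dy (2 : R) = 0 := by exact_mod_cast dy.map_natCast 2
  obtain ⟨k, hk⟩ : ∃ k, k = dz (p + q) := ⟨_, rfl⟩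
  have hkz : dz k = 0 := by rw [hk, hS]
  obtain ⟨l, hl⟩ : ∃ l, l = p + q - z * k := ⟨_, rfl⟩
  have hlz : dz l = 0 := by
    rw [hl, map_sub, ← hk, Derivation.leibniz, hkz, hz, smul_eq_mul, smul_eq_mul]; ring
  -- With D f = dy f + k f and φ = -ε w³ the equations are dz e₂ = D e₁ - 2φ and D e₂ = φ e₁;
  -- integrating the first makes γ = D k / 2 the coefficient of z² in e₂.
  obtain ⟨γ, hγ⟩ : ∃ γ, γ = η * (dy k + k * k) := ⟨_, rfl⟩
  obtain ⟨l1, hl1⟩ : ∃ l1, l1 = dy l + k * l := ⟨_, rfl⟩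
  have hγz : dz γ = 0 := by
    rw [hγ, Derivation.leibniz, dz_dy_add_mul hcomm hkz hkz, hηz]; simp
  have hl1z : dz l1 = 0 := hl1 ▸ dz_dy_add_mul hcomm hkz hlz
  have e1 : p + q = z * k + l := by rw [hl]; ring
  have e1y : dy p + dy q + k * (p + q) = 2 * γ * z + l1 := by
    have := congrArg dy e1
    simp only [map_add, Derivation.leibniz, smul_eq_mul, hzy] at this
    rw [hγ, hl1, this, e1]
    linear_combination -z * (dy k + k * k) * hη
  have hk' : k = dz p + dz q := by rw [hk, map_add]
  obtain ⟨h, hh⟩ : ∃ h, h = p * q - (γ * z ^ 2 + z * l1 - ε * w ^ 2) := ⟨_, rfl⟩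
  have hhz : dz h = 0 := by
    rw [hh]
    simp only [map_sub, map_add, Derivation.leibniz, Derivation.leibniz_pow, smul_eq_mul,
      nsmul_eq_mul, hγz, hl1z, hz, hwz, hεz]
    rw [hp, hq, hk'] at e1y
    push_cast
    linear_combination e1y
  have e2 : p * q = h + γ * z ^ 2 + z * l1 - ε * w ^ 2 := by rw [hh]; ring
  have e2y : dy (p * q) + k * (p * q) = -ε * w ^ 3 * (p + q) := by
    simp only [Derivation.leibniz, smul_eq_mul, hp, hq]
    rw [hk']
    ring
  rw [e1, e2] at e2y
  simp only [map_sub, map_add, Derivation.leibniz, Derivation.leibniz_pow, smul_eq_mul,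
    nsmul_eq_mul, hzy, hwy, hεy] at e2y
  -- Coefficients of zⁿ in z³ (D e₂ - φ e₁). The constant one forces l = 0; those at 3 and 5 say
  -- that h and γ are constant up to the factor λ⁻¹.
  let c : ℕ → R := fun n => match n with
    | 0 => ε * l
    | 3 => dy h + k * h
    | 4 => dy l1 + k * l1
    | 5 => dy γ + k * γ
    | _ => 0
  have hcz : ∀ n, dz (c n) = 0 := by
    intro n
    simp only [c]
    split
    · rw [Derivation.leibniz, hεz, hlz]; simp
    · exact dz_dy_add_mul hcomm hkz hhz
    · exact dz_dy_add_mul hcomm hkz hl1z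
    · exact dz_dy_add_mul hcomm hkz hγz
    · exact map_zero _
  have w2 : z ^ 3 * w ^ 2 = z := by linear_combination (z * (w * z) + z) * hw
  have w3 : z ^ 3 * w ^ 3 = 1 := by linear_combination ((w * z) ^ 2 + w * z + 1) * hw
  have hc := coeff_eq_zero hz 6 c hcz (by
    simp only [Finset.sum_range_succ, Finset.sum_range_zero, c]
    push_cast at e2y
    linear_combination z ^ 3 * e2y + ε * k * w2 - (ε * l + ε * k * z) * w3)
  have hl0 : l = 0 := by
    have h0 : ε * l = 0 := hc 0 (by norm_num)
    linear_combination ε * h0 - l * hε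
  have h3 : dy h + k * h = 0 := hc 3 (by norm_num)
  have h5 : dy γ + k * γ = 0 := hc 5 (by norm_num)
  have hl10 : l1 = 0 := by rw [hl1, hl0]; simp
  have hγ2 : 2 * γ = dy k + k * k := by linear_combination 2 * hγ + (dy k + k * k) * hη
  -- The plane with coordinates α, β, γ, δ reads, after division by z², (α - βy + γy²)(s² - ε w²) +
  -- (β - 2γy) z s + γ z² - δ = 0. The choices of α, β, δ make this s² - (p + q) s + pq = 0.
  refine ⟨k, 1 + (-k + 2 * γ * y) * y - γ * y ^ 2, -k + 2 * γ * y, γ, -h, ⟨?_, ?_, hγz, ?_⟩,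
    ⟨?_, ?_, ?_, ?_⟩, ?_, ?_, ?_⟩
  · simp [Derivation.leibniz, Derivation.leibniz_pow, hkz, n2, hγz, hyz]
  · simp [Derivation.leibniz, hkz, n2, hγz, hyz]
  · rw [map_neg, hhz, neg_zero]
  · simp only [map_sub, map_add, map_neg, Derivation.leibniz, Derivation.leibniz_pow, smul_eq_mul,
      nsmul_eq_mul, hy, n2y, Derivation.map_one_eq_zero]
    push_cast
    linear_combination y ^ 2 * h5 + y * hγ2
  · simp only [map_add, map_neg, Derivation.leibniz, smul_eq_mul, hy, n2y]
    linear_combination 2 * y * h5 + hγ2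
  · linear_combination h5
  · rw [map_neg]
    linear_combination -h3
  · ring
  · rw [e1, hl0]; ring
  · rw [e2, hl10]; ring

end Algebra

section

/-! ### The differential ring of smooth functions on an open set -/

theorem _root_.ContDiffOn.differentiableAt_opens {W : Opens Plane} {F : Plane → ℝ}
    (hF : ContDiffOn ℝ ∞ F W) {p : Plane} (hp : p ∈ W) : DifferentiableAt ℝ F p :=
  (hF.differentiableOn (by simp)).differentiableAt (W.isOpen.mem_nhds hp)

theorem contDiffOn_pd {W : Opens Plane} {F : Plane → ℝ} (hF : ContDiffOn ℝ ∞ F W) (i : Fin 2) :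
    ContDiffOn ℝ ∞ (pd i F) W := by
  have h : ContDiffOn ℝ ∞ (fderiv ℝ F) W := hF.fderiv_of_isOpen W.isOpen (by simp)
  exact h.clm_apply contDiffOn_const

theorem pd_congr {W : Opens Plane} {F G : Plane → ℝ} (h : ∀ q ∈ W, F q = G q) (i : Fin 2)
    {p : Plane} (hp : p ∈ W) : pd i F p = pd i G p := by
  have : F =ᶠ[nhds p] G := Filter.eventually_of_mem (W.isOpen.mem_nhds hp) h
  rw [pd, this.fderiv_eq, pd]

theorem pd_add {F G : Plane → ℝ} {p : Plane} (hF : DifferentiableAt ℝ F p)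
    (hG : DifferentiableAt ℝ G p) (i : Fin 2) :
    pd i (fun q => F q + G q) p = pd i F p + pd i G p := by
  rw [pd, fderiv_fun_add hF hG]; rfl

theorem pd_const_mul {F : Plane → ℝ} {p : Plane} (hF : DifferentiableAt ℝ F p) (r : ℝ)
    (i : Fin 2) : pd i (fun q => r * F q) p = r * pd i F p := by
  rw [pd, fderiv_const_mul hF]; rfl

theorem pd_mul {F G : Plane → ℝ} {p : Plane} (hF : DifferentiableAt ℝ F p)
    (hG : DifferentiableAt ℝ G p) (i : Fin 2) :
    pd i (fun q => F q * G q) p = F p * pd i G p + G p * pd i F p := by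
  rw [pd, fderiv_fun_mul hF hG]; rfl

theorem pd_coord (i j : Fin 2) (p : Plane) :
    pd i (fun q => q j) p = if i = j then 1 else 0 := by
  have : fderiv ℝ (fun q : Plane => q j) p = ContinuousLinearMap.proj j :=
    (ContinuousLinearMap.proj (R := ℝ) (φ := fun _ : Fin 2 => ℝ) j).fderiv
  rw [pd, this]
  simp [Pi.single_apply, eq_comm]

theorem pd_comm {W : Opens Plane} {F : Plane → ℝ} (hF : ContDiffOn ℝ ∞ F W) (i j : Fin 2)
    {p : Plane} (hp : p ∈ W) : pd i (pd j F) p = pd j (pd i F) p := by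
  have h : ContDiffOn ℝ ∞ (fderiv ℝ F) W := hF.fderiv_of_isOpen W.isOpen (by simp)
  have hd : DifferentiableAt ℝ (fderiv ℝ F) p :=
    (h.differentiableOn (by simp)).differentiableAt (W.isOpen.mem_nhds hp)
  have key : ∀ k l : Fin 2, pd k (pd l F) p
      = fderiv ℝ (fderiv ℝ F) p (Pi.single k 1) (Pi.single l 1) := by
    intro k l
    have := (hd.hasFDerivAt.clm_apply (hasFDerivAt_const (Pi.single l (1 : ℝ)) p)).fderiv
    unfold pd
    rw [this]
    simp
  rw [key, key]
  exact (hF.contDiffAt (W.isOpen.mem_nhds hp)).isSymmSndFDerivAt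
    (by simpa using WithTop.coe_le_coe.2 (le_top (a := (2 : ℕ∞)))) _ _

/-- The algebra of smooth functions on `W`. -/
def smoothFunctions (W : Opens Plane) : Subalgebra ℝ (W → ℝ) where
  carrier := {f | ∃ F : Plane → ℝ, ContDiffOn ℝ ∞ F W ∧ ∀ q : W, F q = f q}
  mul_mem' := by
    rintro f f' ⟨F, hF, h⟩ ⟨F', hF', h'⟩
    exact ⟨fun q => F q * F' q, hF.mul hF', fun q => by simp [h, h']⟩
  add_mem' := by
    rintro f f' ⟨F, hF, h⟩ ⟨F', hF', h'⟩
    exact ⟨fun q => F q + F' q, hF.add hF', fun q => by simp [h, h']⟩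
  algebraMap_mem' := fun r => ⟨fun _ => r, contDiffOn_const, fun _ => rfl⟩

variable {W : Opens Plane}

/-- The restriction to `W` of a function that is smooth on `W`. -/
def restrict (F : Plane → ℝ) (hF : ContDiffOn ℝ ∞ F W) : smoothFunctions W :=
  ⟨fun q => F q, F, hF, fun _ => rfl⟩

theorem exists_eq_restrict (f : smoothFunctions W) : ∃ F hF, f = restrict F hF := by
  obtain ⟨F, hF, h⟩ := f.2
  exact ⟨F, hF, Subtype.ext (funext fun q => (h q).symm)⟩

theorem restrict_eq_iff {F G : Plane → ℝ} {hF : ContDiffOn ℝ ∞ F W} {hG : ContDiffOn ℝ ∞ G W} :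
    restrict F hF = restrict G hG ↔ ∀ q ∈ W, F q = G q :=
  ⟨fun h q hq => congrFun (congrArg Subtype.val h) ⟨q, hq⟩,
    fun h => Subtype.ext (funext fun q => h q q.2)⟩

theorem restrict_add {F G : Plane → ℝ} (hF : ContDiffOn ℝ ∞ F W) (hG : ContDiffOn ℝ ∞ G W) :
    restrict F hF + restrict G hG = restrict (fun q => F q + G q) (hF.add hG) := rfl

theorem restrict_neg {F : Plane → ℝ} (hF : ContDiffOn ℝ ∞ F W) :
    -restrict F hF = restrict (fun q => -F q) hF.neg := rfl

theorem restrict_mul {F G : Plane → ℝ} (hF : ContDiffOn ℝ ∞ F W) (hG : ContDiffOn ℝ ∞ G W) :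
    restrict F hF * restrict G hG = restrict (fun q => F q * G q) (hF.mul hG) := rfl

/-- An extension to the plane of a smooth function on `W`. -/
noncomputable def extension (f : smoothFunctions W) : Plane → ℝ := f.2.choose

theorem contDiffOn_extension (f : smoothFunctions W) : ContDiffOn ℝ ∞ (extension f) W :=
  f.2.choose_spec.1

theorem extension_apply (f : smoothFunctions W) {q : Plane} (hq : q ∈ W) :
    extension f q = f.1 ⟨q, hq⟩ := f.2.choose_spec.2 ⟨q, hq⟩

theorem differentiableAt_extension (f : smoothFunctions W) (q : W) :
    DifferentiableAt ℝ (extension f) q := (contDiffOn_extension f).differentiableAt_opens q.2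

/-- The partial derivatives, as derivations of the algebra of smooth functions. -/
noncomputable def pdDerivation (W : Opens Plane) (i : Fin 2) :
    Derivation ℝ (smoothFunctions W) (smoothFunctions W) :=
  Derivation.mk'
    { toFun := fun f => restrict (pd i (extension f)) (contDiffOn_pd (contDiffOn_extension f) i)
      map_add' := by
        refine fun f g => Subtype.ext (funext fun q => ?_)
        change pd i _ q = pd i _ q + pd i _ q
        rw [← pd_add (differentiableAt_extension f q) (differentiableAt_extension g q)]
        refine pd_congr (fun q hq => ?_) i q.2
        rw [extension_apply _ hq, extension_apply _ hq, extension_apply _ hq]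
        rfl
      map_smul' := by
        refine fun r f => Subtype.ext (funext fun q => ?_)
        change pd i _ q = r * pd i _ q
        rw [← pd_const_mul (differentiableAt_extension f q)]
        refine pd_congr (fun q hq => ?_) i q.2
        rw [extension_apply _ hq, extension_apply _ hq]
        rfl }
    (by
      refine fun f g => Subtype.ext (funext fun q => ?_)
      change pd i _ q = f.1 q * pd i _ q + g.1 q * pd i _ q
      rw [← extension_apply f q.2, ← extension_apply g q.2,
        ← pd_mul (differentiableAt_extension f q) (differentiableAt_extension g q)]
      refine pd_congr (fun q hq => ?_) i q.2
      rw [extension_apply _ hq, extension_apply _ hq, extension_apply _ hq]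
      rfl)

/-- The chosen extension agrees with F on the open set W, so the choice does not affect derivatives
there. -/
theorem pdDerivation_restrict {F : Plane → ℝ} (hF : ContDiffOn ℝ ∞ F W) (i : Fin 2) :
    pdDerivation W i (restrict F hF) = restrict (pd i F) (contDiffOn_pd hF i) :=
  Subtype.ext (funext fun q => pd_congr (fun _ hq => extension_apply (restrict F hF) hq) i q.2)

theorem pdDerivation_comm (i j : Fin 2) (f : smoothFunctions W) :
    pdDerivation W i (pdDerivation W j f) = pdDerivation W j (pdDerivation W i f) := by
  obtain ⟨F, hF, rfl⟩ := exists_eq_restrict f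
  simp only [pdDerivation_restrict]
  exact restrict_eq_iff.2 fun q hq => pd_comm hF i j hq

theorem contDiffOn_coord_fun (j : Fin 2) (s : Set Plane) : ContDiffOn ℝ ∞ (fun q : Plane => q j) s :=
  (contDiff_apply ℝ ℝ j).contDiffOn

/-- The coordinates, as smooth functions. -/
def coord (W : Opens Plane) (j : Fin 2) : smoothFunctions W :=
  restrict (fun q => q j) (contDiffOn_coord_fun j W)

theorem pdDerivation_coord (i j : Fin 2) :
    pdDerivation W i (coord W j) = if i = j then 1 else 0 := by
  rw [coord, pdDerivation_restrict]
  ext q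
  change pd i (fun q => q j) q = _
  rw [pd_coord]
  split_ifs <;> rfl

end

section

/-! ### Points of the dual space -/

theorem mem_quadric_mk {ε : ℝ} {x : Fin 4 → ℝ} (hx : x ≠ 0) :
    Projectivization.mk ℝ x hx ∈ quadric ε ↔ x 0 * x 2 - x 1 ^ 2 + ε * x 3 ^ 2 = 0 := by
  obtain ⟨a, ha⟩ := Projectivization.exists_smul_eq_mk_rep ℝ x hx
  have h : ∀ i, (Projectivization.mk ℝ x hx).rep i = (a : ℝ) * x i := fun i => by
    rw [← ha]; rfl
  simp only [quadric, Set.mem_ofPred_eq, h]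
  rw [show (a : ℝ) * x 0 * (a * x 2) - (a * x 1) ^ 2 + ε * (a * x 3) ^ 2
    = (a : ℝ) ^ 2 * (x 0 * x 2 - x 1 ^ 2 + ε * x 3 ^ 2) by ring]
  simp

theorem mem_conic_mk {x : Fin 4 → ℝ} (hx : x ≠ 0) {p : Plane} :
    p ∈ conic (Projectivization.mk ℝ x hx) ↔
      x 0 * p 1 ^ 2 + 2 * x 1 * p 1 + x 2 + x 3 * p 0 ^ 2 = 0 := by
  obtain ⟨a, ha⟩ := Projectivization.exists_smul_eq_mk_rep ℝ x hx
  have h : ∀ i, (Projectivization.mk ℝ x hx).rep i = (a : ℝ) * x i := fun i => by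
    rw [← ha]; rfl
  simp only [conic, Set.mem_ofPred_eq, h]
  rw [show (a : ℝ) * x 0 * p 1 ^ 2 + 2 * (a * x 1) * p 1 + a * x 2 + a * x 3 * p 0 ^ 2
    = (a : ℝ) * (x 0 * p 1 ^ 2 + 2 * x 1 * p 1 + x 2 + x 3 * p 0 ^ 2) by ring]
  simp

theorem mem_plane_iff {X H : RP3} {x : Fin 4 → ℝ} {r : ℝ} (hr : r ≠ 0) (h : X.rep = r • x) :
    X ∈ plane H ↔ ∑ i, H.rep i * x i = 0 := by
  have : ∑ i, H.rep i * X.rep i = r * ∑ i, H.rep i * x i := by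
    rw [Finset.mul_sum, h]
    exact Finset.sum_congr rfl fun i _ => by simp; ring
  rw [plane, Set.mem_ofPred_eq, this]
  simp [hr]

/-- The point of the quadric representing the geodesic through `p` with the velocity `v`. -/
def contact (ε : ℝ) (p v : Plane) : Fin 4 → ℝ :=
  ![p 0 ^ 2 * v 0 ^ 2 - ε * v 1 ^ 2,
    p 0 ^ 3 * v 0 * v 1 - (p 0 ^ 2 * v 0 ^ 2 - ε * v 1 ^ 2) * p 1,
    p 0 ^ 4 * v 1 ^ 2 + (p 0 ^ 2 * v 0 ^ 2 - ε * v 1 ^ 2) * p 1 ^ 2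
      - 2 * p 0 ^ 3 * v 0 * v 1 * p 1,
    -(p 0 ^ 2 * v 1 ^ 2)]

theorem contact_quadric (ε : ℝ) (p v : Plane) : contact ε p v 0 * contact ε p v 2
    - contact ε p v 1 ^ 2 + ε * contact ε p v 3 ^ 2 = 0 := by
  simp [contact]; ring

theorem contact_conic (ε : ℝ) (p v : Plane) : contact ε p v 0 * p 1 ^ 2
    + 2 * contact ε p v 1 * p 1 + contact ε p v 2 + contact ε p v 3 * p 0 ^ 2 = 0 := by
  simp [contact]; ring

theorem contact_ne_zero (ε : ℝ) {p v : Plane} (hp : p 0 ≠ 0) (hv : v ≠ 0) :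
    contact ε p v ≠ 0 := by
  intro h
  have h3 : v 1 = 0 := by simpa [contact, hp] using congrFun h 3
  have h0 : v 0 = 0 := by simpa [contact, hp, h3] using congrFun h 0
  exact hv (funext fun i => by fin_cases i <;> assumption)

theorem contact_smul (ε r : ℝ) (p v : Plane) : contact ε p (r • v) = r ^ 2 • contact ε p v := by
  funext i
  fin_cases i <;> simp [contact] <;> ring

/-- A conic of the quadric is determined by a point and the tangent line at it. -/
theorem exists_eq_smul_contact {ε : ℝ} {x : Fin 4 → ℝ} (hx : x ≠ 0) {p v : Plane} (hp : p 0 ≠ 0)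
    (hv : v ≠ 0) (hQ : x 0 * x 2 - x 1 ^ 2 + ε * x 3 ^ 2 = 0)
    (hC : x 0 * p 1 ^ 2 + 2 * x 1 * p 1 + x 2 + x 3 * p 0 ^ 2 = 0)
    (hT : (x 0 * p 1 + x 1) * v 1 + x 3 * p 0 * v 0 = 0) (hD : x 3 = 0 → v 1 = 0) :
    ∃ r : ℝ, r ≠ 0 ∧ x = r • contact ε p v := by
  suffices h : ∃ r : ℝ, x = r • contact ε p v by
    obtain ⟨r, hr⟩ := h
    refine ⟨r, ?_, hr⟩
    rintro rfl
    exact hx (by rw [hr, zero_smul])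
  by_cases hw : v 1 = 0
  · have hv0 : v 0 ≠ 0 := fun h => hv (funext fun i => by fin_cases i <;> assumption)
    have h3 : x 3 = 0 := by simpa [hw, hp, hv0] using hT
    have h1 : x 1 = -(x 0 * p 1) := by
      have : (x 0 * p 1 + x 1) ^ 2 = 0 := by
        rw [h3] at hQ hC
        linear_combination x 0 * hC - hQ
      linear_combination pow_eq_zero_iff two_ne_zero |>.1 this
    refine ⟨x 0 / (p 0 ^ 2 * v 0 ^ 2), funext fun i => ?_⟩
    fin_cases i
    · simp [contact, hw]; field_simp
    · simp [contact, hw, h1]; field_simp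
    · simp [contact, hw]; field_simp
      rw [h3, h1] at hC
      linear_combination hC
    · simp [contact, hw, h3]
  · have h3 : x 3 ≠ 0 := fun h => hw (hD h)
    -- The quadric and the conic give (x₀y + x₁)² = -x₀x₃z² + εx₃², and tangency gives (x₀y + x₁)²
    -- v₁² = x₃²z²v₀²; a factor x₃ is cancelled.
    have h0 : x 0 * (p 0 ^ 2 * v 1 ^ 2) = -x 3 * (p 0 ^ 2 * v 0 ^ 2 - ε * v 1 ^ 2) := by
      refine mul_left_cancel₀ h3 ?_
      linear_combination v 1 ^ 2 * x 0 * hC - v 1 ^ 2 * hQ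
        - ((x 0 * p 1 + x 1) * v 1 - x 3 * p 0 * v 0) * hT
    have h1 : x 1 * (p 0 ^ 2 * v 1 ^ 2) = -x 3 * contact ε p v 1 := by
      simp only [contact, Matrix.cons_val]
      linear_combination p 0 ^ 2 * v 1 * hT - p 1 * h0
    have h2 : x 2 * (p 0 ^ 2 * v 1 ^ 2) = -x 3 * contact ε p v 2 := by
      simp only [contact, Matrix.cons_val] at h1 ⊢
      linear_combination (p 0 ^ 2 * v 1 ^ 2) * hC - 2 * p 1 * h1 - p 1 ^ 2 * h0
    refine ⟨-x 3 / (p 0 ^ 2 * v 1 ^ 2), funext fun i => ?_⟩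
    rw [Pi.smul_apply, smul_eq_mul, div_mul_eq_mul_div, eq_div_iff (by positivity)]
    fin_cases i
    · exact h0
    · exact h1
    · exact h2
    · simp [contact]

/-- A nowhere vanishing vector function whose derivative is proportional to it has a constant
direction. -/
theorem exists_eq_smul_of_hasFDerivAt {E ι : Type*} [NormedAddCommGroup E] [NormedSpace ℝ E]
    [Fintype ι] {s : Set E} (hs : IsOpen s) (hs' : IsPreconnected s) {x : E → ι → ℝ}
    {x' : E → ι → E →L[ℝ] ℝ} (hx : ∀ p ∈ s, ∀ i, HasFDerivAt (fun q => x q i) (x' p i) p)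
    (h0 : ∀ p ∈ s, x p ≠ 0) (h : ∀ p ∈ s, ∀ i j, x p i • x' p j = x p j • x' p i)
    {p q : E} (hp : p ∈ s) (hq : q ∈ s) : ∃ r : ℝ, r ≠ 0 ∧ x p = r • x q := by
  have hN : ∀ p ∈ s, ∑ i, x p i ^ 2 ≠ 0 := by
    intro p hp hz
    rw [Finset.sum_eq_zero_iff_of_nonneg fun i _ => sq_nonneg _] at hz
    exact h0 p hp (funext fun i => by simpa using hz i (Finset.mem_univ i))
  -- The matrix of the orthogonal projection onto the line of x is insensitive to scaling, so its
  -- derivative vanishes and it is constant on the connected set.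
  have hconst : ∀ i j, x p i * x p j / ∑ k, x p k ^ 2 = x q i * x q j / ∑ k, x q k ^ 2 := by
    intro i j
    have hd : ∀ p ∈ s, HasFDerivAt (fun p => x p i * x p j / ∑ k, x p k ^ 2) (0 : E →L[ℝ] ℝ) p := by
      intro p hp
      have hsum : HasFDerivAt (fun p => ∑ k, x p k ^ 2) (∑ k, (2 * x p k) • x' p k) p :=
        HasFDerivAt.fun_sum fun k _ => by
          simpa using (hx p hp k).pow 2
      have hinv := (hasDerivAt_inv (hN p hp)).comp_hasFDerivAt p hsum
      refine (((hx p hp i).mul (hx p hp j)).mul hinv).congr_fderiv ?_ |>.congr_of_eventuallyEq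
        (Filter.Eventually.of_forall fun _ => div_eq_mul_inv _ _)
      refine ContinuousLinearMap.ext fun v => ?_
      have key : (∑ k, x p k ^ 2) * (x p i * x' p j v + x p j * x' p i v)
          = x p i * x p j * ∑ k, 2 * x p k * x' p k v := by
        rw [Finset.sum_mul, Finset.mul_sum]
        refine Finset.sum_congr rfl fun k _ => ?_
        have h1 := congrArg (fun f => f v) (h p hp k i)
        have h2 := congrArg (fun f => f v) (h p hp k j)
        simp only [smul_apply, smul_eq_mul] at h1 h2
        linear_combination x p k * x p i * h2 + x p k * x p j * h1
      have hNp := hN p hp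
      simp only [smul_apply, add_apply, sum_apply, smul_eq_mul, zero_apply, Pi.mul_apply,
        Function.comp_apply]
      field_simp
      linear_combination key
    exact hs.is_const_of_fderiv_eq_zero hs'
      (fun p hp => (hd p hp).differentiableAt.differentiableWithinAt)
      (fun p hp => (hd p hp).fderiv) hp hq
  obtain ⟨j, hj⟩ : ∃ j, x p j ≠ 0 := by
    by_contra! hc
    exact h0 p hp (funext hc)
  have hjq : x q j ≠ 0 := by
    intro hz
    have := hconst j j
    rw [hz, mul_zero, zero_div, div_eq_zero_iff] at this
    rcases this with h1 | h1
    · exact hj (by simpa using h1)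
    · exact hN p hp h1
  have hr : ∀ i, x p i = x p j / x q j * x q i := by
    intro i
    have h1 := hconst i j
    have h2 := hconst j j
    have hNp := hN p hp
    have hNq := hN q hq
    rw [div_eq_div_iff hNp hNq] at h1 h2
    have h3 : x p j * (x p i * x q j) * ∑ k, x q k ^ 2
        = x p j * (x p j * x q i) * ∑ k, x q k ^ 2 := by
      linear_combination x q j * h1 - x q i * h2
    have h4 := mul_left_cancel₀ hj (mul_right_cancel₀ hNq h3)
    field_simp
    linear_combination h4
  exact ⟨x p j / x q j, div_ne_zero hj hjq, funext hr⟩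

end

section

/-! ### Geodesic arcs and conics -/

theorem IsRegularArc.hasDerivAt {U : Set Plane} {a b : ℝ} {c : ℝ → Plane}
    (hc : IsRegularArc U a b c) {t : ℝ} (ht : t ∈ Set.Ioo a b) (i : Fin 2) :
    HasDerivAt (fun s => c s i) (deriv c t i) t := by
  have h := (hc.contDiffOn.differentiableOn two_ne_zero).differentiableAt (isOpen_Ioo.mem_nhds ht)
  exact hasDerivAt_pi.1 h.hasDerivAt i

theorem IsRegularArc.hasDerivAt_deriv {U : Set Plane} {a b : ℝ} {c : ℝ → Plane}
    (hc : IsRegularArc U a b c) {t : ℝ} (ht : t ∈ Set.Ioo a b) (i : Fin 2) :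
    HasDerivAt (fun s => deriv c s i) (deriv (deriv c) t i) t := by
  have h1 : ContDiffOn ℝ 1 (deriv c) (Set.Ioo a b) :=
    hc.contDiffOn.deriv_of_isOpen isOpen_Ioo (by norm_num)
  have h := (h1.differentiableOn one_ne_zero).differentiableAt (isOpen_Ioo.mem_nhds ht)
  exact hasDerivAt_pi.1 h.hasDerivAt i

theorem christoffel_symm {g : Plane → Matrix (Fin 2) (Fin 2) ℝ} {U : Opens Plane}
    (hg : IsMetricOn g U) (i j k : Fin 2) {p : Plane} (hp : p ∈ U) :
    christoffel g i j k p = christoffel g i k j p := by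
  unfold christoffel
  congr 1
  refine Finset.sum_congr rfl fun m _ => ?_
  rw [pd_congr (W := U) (F := fun q => g q j k) (G := fun q => g q k j)
    (fun q hq => (hg.symm q hq).apply k j) m hp]
  ring

theorem cubic_coeffs {a b c d e : ℝ} (h : ∀ s : ℝ, a + b * s - c * s ^ 2 + d * s ^ 3 = e * s ^ 3) :
    a = 0 ∧ b = 0 ∧ c = 0 ∧ d = e := by
  have h0 := h 0
  have h1 := h 1
  have h2 := h (-1)
  have h3 := h 2
  norm_num at h0 h1 h2 h3
  refine ⟨?_, ?_, ?_, ?_⟩ <;> linarith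

variable {g : Plane → Matrix (Fin 2) (Fin 2) ℝ} {U : Opens Plane} {ε : ℝ}

/-- Proportionality of covariant acceleration and velocity is the vanishing of their determinant.
Its part cubic in the velocity has exactly the coefficients of `geodesicRHS`, which the normal
equation determines since it holds for every slope. -/
theorem isGeodesicArc_iff (hg : IsMetricOn g U) (hn : IsNormalCoordinates g U ε) {a b : ℝ}
    {c : ℝ → Plane} (hc : IsRegularArc U a b c) :
    IsGeodesicArc g a b c ↔ ∀ t ∈ Set.Ioo a b,
      c t 0 ^ 3 * (deriv (deriv c) t 0 * deriv c t 1 - deriv (deriv c) t 1 * deriv c t 0)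
        + ε * deriv c t 1 ^ 3 = 0 := by
  refine forall₂_congr fun t ht => ?_
  have hp := hc.mem t ht
  have hz := hn.ne_zero _ hp
  have hv := hc.deriv_ne_zero t ht
  generalize c t = p at *
  generalize deriv (deriv c) t = α
  generalize deriv c t = v at *
  have heq := hn.equation p hp
  simp only [geodesicRHS] at heq
  have s0 := christoffel_symm hg 0 1 0 hp
  have s1 := christoffel_symm hg 1 1 0 hp
  obtain ⟨h0, h1, h2, h3⟩ := cubic_coeffs (a := -christoffel g 1 0 0 p)
    (b := christoffel g 0 0 0 p - 2 * christoffel g 1 0 1 p)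
    (c := christoffel g 1 1 1 p - 2 * christoffel g 0 0 1 p) (d := christoffel g 0 1 1 p)
    (e := ε / p 0 ^ 3) fun s => by
      rw [div_mul_eq_mul_div, eq_div_iff (pow_ne_zero 3 hz), mul_comm]
      exact heq s
  simp only [Fin.sum_univ_two, Fin.forall_fin_two, s0, s1]
  have key : p 0 ^ 3 * (α 0 * v 1 - α 1 * v 0) + ε * v 1 ^ 3 = p 0 ^ 3 *
      ((α 0 + (christoffel g 0 0 0 p * v 0 * v 0 + christoffel g 0 0 1 p * v 0 * v 1
        + (christoffel g 0 0 1 p * v 1 * v 0 + christoffel g 0 1 1 p * v 1 * v 1))) * v 1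
      - (α 1 + (christoffel g 1 0 0 p * v 0 * v 0 + christoffel g 1 0 1 p * v 0 * v 1
        + (christoffel g 1 0 1 p * v 1 * v 0 + christoffel g 1 1 1 p * v 1 * v 1))) * v 0) := by
    rw [eq_div_iff (pow_ne_zero 3 hz)] at h3
    linear_combination -v 1 ^ 3 * h3 - p 0 ^ 3 * (v 0 ^ 3 * h0 + v 0 ^ 2 * v 1 * h1
      - v 0 * v 1 ^ 2 * h2)
  rw [key]
  constructor
  · rintro ⟨r, hr0, hr1⟩
    rw [hr0, hr1]; ring
  · intro h
    have h' := (mul_eq_zero.1 h).resolve_left (pow_ne_zero 3 hz)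
    by_cases hw : v 1 = 0
    · have hv0 : v 0 ≠ 0 := fun h => hv (funext fun i => by fin_cases i <;> assumption)
      rw [hw] at h' ⊢
      refine ⟨_, (div_mul_cancel₀ _ hv0).symm, ?_⟩
      rw [mul_zero, zero_sub, neg_eq_zero] at h'
      exact ((mul_eq_zero.1 h').resolve_right hv0).trans (mul_zero _).symm
    · refine ⟨_, ?_, (div_mul_cancel₀ _ hw).symm⟩
      rw [div_mul_eq_mul_div, eq_div_iff hw]
      linarith

theorem quadric_eq {X : RP3} (hX : X ∈ quadric ε) :
    X.rep 0 * X.rep 2 - X.rep 1 ^ 2 + ε * X.rep 3 ^ 2 = 0 := hX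

theorem conic_eq {X : RP3} {p : Plane} (hX : p ∈ conic X) :
    X.rep 0 * p 1 ^ 2 + 2 * X.rep 1 * p 1 + X.rep 2 + X.rep 3 * p 0 ^ 2 = 0 := hX

/-- The double lines of the quadric. -/
theorem eq_of_rep_three_eq_zero {X : RP3} (hX : X ∈ quadric ε) (h3 : X.rep 3 = 0) {p : Plane}
    (hp : p ∈ conic X) : X.rep 0 ≠ 0 ∧ X.rep 0 * p 1 + X.rep 1 = 0 := by
  have hQ := quadric_eq hX
  have hC := conic_eq hp
  rw [h3] at hQ hC
  have h1 : X.rep 0 * p 1 + X.rep 1 = 0 := by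
    have : (X.rep 0 * p 1 + X.rep 1) ^ 2 = 0 := by linear_combination X.rep 0 * hC - hQ
    exact pow_eq_zero_iff two_ne_zero |>.1 this
  refine ⟨fun h0 => X.rep_nonzero (funext fun i => ?_), h1⟩
  have h1' : X.rep 1 = 0 := by simpa [h0] using h1
  have h2 : X.rep 2 = 0 := by simpa [h0, h1'] using hC
  fin_cases i <;> assumption

theorem IsRegularArc.tangent_eq {a b : ℝ} {c : ℝ → Plane} {U : Set Plane}
    (hc : IsRegularArc U a b c) {X : RP3}
    (hX : ∀ t ∈ Set.Ioo a b, c t ∈ conic X) {t : ℝ} (ht : t ∈ Set.Ioo a b) :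
    (X.rep 0 * c t 1 + X.rep 1) * deriv c t 1 + X.rep 3 * c t 0 * deriv c t 0 = 0 := by
  have h0 := hc.hasDerivAt ht 0
  have h1 := hc.hasDerivAt ht 1
  have hd := ((((h1.fun_pow 2).const_mul (X.rep 0)).fun_add (h1.const_mul (2 * X.rep 1))).add_const
    (X.rep 2)).fun_add ((h0.fun_pow 2).const_mul (X.rep 3))
  have hz : (fun s => X.rep 0 * c s 1 ^ 2 + 2 * X.rep 1 * c s 1 + X.rep 2 + X.rep 3 * c s 0 ^ 2)
      =ᶠ[nhds t] fun _ => 0 :=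
    Filter.eventually_of_mem (isOpen_Ioo.mem_nhds ht) fun s hs => conic_eq (hX s hs)
  have := hd.unique ((hasDerivAt_const t 0).congr_of_eventuallyEq hz)
  push_cast at this
  linear_combination this / 2

/-- The tangency equation says nothing on a double line, so the equation of the line itself is
differentiated. -/
theorem IsRegularArc.horizontal {a b : ℝ} {c : ℝ → Plane} {U : Set Plane}
    (hc : IsRegularArc U a b c) {X : RP3} (hQ : X ∈ quadric ε)
    (hX : ∀ t ∈ Set.Ioo a b, c t ∈ conic X) (h3 : X.rep 3 = 0) {t : ℝ} (ht : t ∈ Set.Ioo a b) :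
    deriv c t 1 = 0 := by
  have h0 := (eq_of_rep_three_eq_zero hQ h3 (hX t ht)).1
  have hd := ((hc.hasDerivAt ht 1).const_mul (X.rep 0)).add_const (X.rep 1)
  have hz : (fun s => X.rep 0 * c s 1 + X.rep 1) =ᶠ[nhds t] fun _ => 0 :=
    Filter.eventually_of_mem (isOpen_Ioo.mem_nhds ht) fun s hs =>
      (eq_of_rep_three_eq_zero hQ h3 (hX s hs)).2
  have := hd.unique ((hasDerivAt_const t 0).congr_of_eventuallyEq hz)
  exact (mul_eq_zero.1 this).resolve_left h0

/-- The point of the quadric carrying an arc is the contact point of the arc. -/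
theorem IsRegularArc.rep_eq_smul_contact {a b : ℝ} {c : ℝ → Plane} {U : Set Plane}
    (hU : ∀ p ∈ U, p 0 ≠ 0) (hc : IsRegularArc U a b c) {X : RP3} (hQ : X ∈ quadric ε)
    (hX : ∀ t ∈ Set.Ioo a b, c t ∈ conic X) {t : ℝ} (ht : t ∈ Set.Ioo a b) :
    ∃ r : ℝ, r ≠ 0 ∧ X.rep = r • contact ε (c t) (deriv c t) :=
  exists_eq_smul_contact X.rep_nonzero (hU _ (hc.mem t ht)) (hc.deriv_ne_zero t ht)
    (quadric_eq hQ) (conic_eq (hX t ht)) (hc.tangent_eq hX ht)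
    (fun h3 => hc.horizontal hQ hX h3 ht)

theorem eq_of_rep_eq_smul {X Y : RP3} {x : Fin 4 → ℝ} {r s : ℝ}
    (hX : X.rep = r • x) (hs : s ≠ 0) (hY : Y.rep = s • x) : X = Y := by
  rw [← X.mk_rep, ← Y.mk_rep, Projectivization.mk_eq_mk_iff']
  refine ⟨r / s, ?_⟩
  rw [hY, hX, smul_smul, div_mul_cancel₀ _ hs]

theorem IsRegularArc.eq_of_mem_conic {a b : ℝ} {c : ℝ → Plane} {U : Set Plane}
    (hU : ∀ p ∈ U, p 0 ≠ 0) (hc : IsRegularArc U a b c) {X Y : RP3} (hX : X ∈ quadric ε)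
    (hY : Y ∈ quadric ε) (hcX : ∀ t ∈ Set.Ioo a b, c t ∈ conic X)
    (hcY : ∀ t ∈ Set.Ioo a b, c t ∈ conic Y) : X = Y := by
  obtain ⟨t, ht⟩ := Set.nonempty_Ioo.2 hc.lt
  obtain ⟨r, -, h1⟩ := hc.rep_eq_smul_contact hU hX hcX ht
  obtain ⟨s, hs, h2⟩ := hc.rep_eq_smul_contact hU hY hcY ht
  exact eq_of_rep_eq_smul h1 hs h2

theorem IsRegularArc.equation_of_mem_conic {a b : ℝ} {c : ℝ → Plane} {U : Set Plane}
    (hc : IsRegularArc U a b c) {X : RP3} (hQ : X ∈ quadric ε)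
    (hX : ∀ t ∈ Set.Ioo a b, c t ∈ conic X) {t : ℝ} (ht : t ∈ Set.Ioo a b) :
    c t 0 ^ 3 * (deriv (deriv c) t 0 * deriv c t 1 - deriv (deriv c) t 1 * deriv c t 0)
      + ε * deriv c t 1 ^ 3 = 0 := by
  have h0 := hc.hasDerivAt ht 0
  have h1 := hc.hasDerivAt ht 1
  have g0 := hc.hasDerivAt_deriv ht 0
  have g1 := hc.hasDerivAt_deriv ht 1
  by_cases h3 : X.rep 3 = 0
  · have hw : ∀ s ∈ Set.Ioo a b, deriv c s 1 = 0 := fun s hs => hc.horizontal hQ hX h3 hs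
    have hz : (fun s => deriv c s 1) =ᶠ[nhds t] fun _ => 0 :=
      Filter.eventually_of_mem (isOpen_Ioo.mem_nhds ht) hw
    have := g1.unique ((hasDerivAt_const t 0).congr_of_eventuallyEq hz)
    rw [this, hw t ht]; ring
  · have hd := (((h1.const_mul (X.rep 0)).add_const (X.rep 1)).fun_mul g1).fun_add
      ((h0.const_mul (X.rep 3)).fun_mul g0)
    have hz : (fun s => (X.rep 0 * c s 1 + X.rep 1) * deriv c s 1
        + X.rep 3 * c s 0 * deriv c s 0) =ᶠ[nhds t] fun _ => 0 :=
      Filter.eventually_of_mem (isOpen_Ioo.mem_nhds ht) fun s hs => hc.tangent_eq hX hs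
    have h2 := hd.unique ((hasDerivAt_const t 0).congr_of_eventuallyEq hz)
    have hT := hc.tangent_eq hX ht
    have hC := conic_eq (hX t ht)
    have hQ := quadric_eq hQ
    -- `h2` is the second derivative of the conic equation. Tangency eliminates the first-order
    -- terms, and the identity for (x₀y + x₁)² from `exists_eq_smul_contact` does the rest.
    refine (mul_eq_zero.1 (?_ : X.rep 3 ^ 2 * _ = 0)).resolve_left (pow_ne_zero 2 h3)
    generalize c t = p at *
    generalize deriv (deriv c) t = α at *
    generalize deriv c t = v at *
    linear_combination X.rep 3 * p 0 ^ 2 * v 1 * h2 - X.rep 3 * p 0 ^ 2 * α 1 * hT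
      - v 1 * (v 1 ^ 2 * X.rep 0 * hC - v 1 ^ 2 * hQ
        - ((X.rep 0 * p 1 + X.rep 1) * v 1 - X.rep 3 * p 0 * v 0) * hT)

/-- The parametrization is arbitrary and `contact` is quadratic in the velocity, so only its
direction can be constant. Each 2 × 2 minor of `contact` and its derivative is a multiple of the
geodesic expression `hE`. -/
theorem contact_const {a b : ℝ} {c : ℝ → Plane} {U : Set Plane}
    (hU : ∀ p ∈ U, p 0 ≠ 0) (hc : IsRegularArc U a b c)
    (h : ∀ t ∈ Set.Ioo a b,
      c t 0 ^ 3 * (deriv (deriv c) t 0 * deriv c t 1 - deriv (deriv c) t 1 * deriv c t 0)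
        + ε * deriv c t 1 ^ 3 = 0) {s t : ℝ} (hs : s ∈ Set.Ioo a b) (ht : t ∈ Set.Ioo a b) :
    ∃ r : ℝ, r ≠ 0 ∧ contact ε (c s) (deriv c s) = r • contact ε (c t) (deriv c t) := by
  let A' : ℝ → ℝ := fun t => 2 * c t 0 * deriv c t 0 ^ 3
    + 2 * c t 0 ^ 2 * deriv c t 0 * deriv (deriv c) t 0
    - 2 * ε * deriv c t 1 * deriv (deriv c) t 1
  let B' : ℝ → ℝ := fun t => 3 * c t 0 ^ 2 * deriv c t 0 ^ 2 * deriv c t 1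
    + c t 0 ^ 3 * (deriv (deriv c) t 0 * deriv c t 1 + deriv c t 0 * deriv (deriv c) t 1)
  let x' : ℝ → Fin 4 → ℝ := fun t => ![A' t,
    B' t - (A' t * c t 1 + (c t 0 ^ 2 * deriv c t 0 ^ 2 - ε * deriv c t 1 ^ 2) * deriv c t 1),
    4 * c t 0 ^ 3 * deriv c t 0 * deriv c t 1 ^ 2
      + 2 * c t 0 ^ 4 * deriv c t 1 * deriv (deriv c) t 1
      + (A' t * c t 1 ^ 2
        + (c t 0 ^ 2 * deriv c t 0 ^ 2 - ε * deriv c t 1 ^ 2) * (2 * c t 1 * deriv c t 1))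
      - 2 * (B' t * c t 1 + c t 0 ^ 3 * deriv c t 0 * deriv c t 1 * deriv c t 1),
    -(2 * c t 0 * deriv c t 0 * deriv c t 1 ^ 2
      + 2 * c t 0 ^ 2 * deriv c t 1 * deriv (deriv c) t 1)]
  have hx : ∀ t ∈ Set.Ioo a b, ∀ i,
      HasDerivAt (fun t => contact ε (c t) (deriv c t) i) (x' t i) t := by
    intro t ht i
    have h0 := hc.hasDerivAt ht 0
    have h1 := hc.hasDerivAt ht 1
    have g0 := hc.hasDerivAt_deriv ht 0
    have g1 := hc.hasDerivAt_deriv ht 1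
    have hA := ((h0.fun_pow 2).fun_mul (g0.fun_pow 2)).fun_sub ((g1.fun_pow 2).const_mul ε)
    have hB := ((h0.fun_pow 3).fun_mul g0).fun_mul g1
    fin_cases i
    · refine hA.congr_deriv ?_
      simp [x', A']; ring
    · refine (hB.fun_sub (hA.fun_mul h1)).congr_deriv ?_
      simp [x', A', B']; ring
    · refine ((((h0.fun_pow 4).fun_mul (g1.fun_pow 2)).fun_add (hA.fun_mul (h1.fun_pow 2))).fun_sub
        ((((h0.fun_pow 3).const_mul 2).fun_mul g0).fun_mul g1 |>.fun_mul h1)).congr_deriv ?_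
      simp [x', A', B']; ring
    · refine ((h0.fun_pow 2).fun_mul (g1.fun_pow 2)).fun_neg.congr_deriv ?_
      simp [x']; ring
  refine exists_eq_smul_of_hasFDerivAt (x := fun t => contact ε (c t) (deriv c t)) isOpen_Ioo
    isPreconnected_Ioo (fun t ht i => (hx t ht i).hasFDerivAt)
    (fun t ht => contact_ne_zero ε (hU _ (hc.mem t ht)) (hc.deriv_ne_zero t ht)) ?_ hs ht
  intro t ht i j
  refine ContinuousLinearMap.ext fun τ => ?_
  simp only [smul_apply, ContinuousLinearMap.toSpanSingleton_apply, smul_eq_mul]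
  suffices hm : contact ε (c t) (deriv c t) i * x' t j = contact ε (c t) (deriv c t) j * x' t i by
    linear_combination τ * hm
  have hE := h t ht
  simp only [x', A', B']
  generalize c t = p at *
  generalize deriv (deriv c) t = α at *
  generalize deriv c t = v at *
  have key : ∀ x y : Fin 4 → ℝ, x 0 * y 1 = x 1 * y 0 → x 0 * y 2 = x 2 * y 0 →
      x 0 * y 3 = x 3 * y 0 → x 1 * y 2 = x 2 * y 1 → x 1 * y 3 = x 3 * y 1 →
      x 2 * y 3 = x 3 * y 2 → x i * y j = x j * y i := by
    intro x y h01 h02 h03 h12 h13 h23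
    fin_cases i <;> fin_cases j <;> first | rfl | assumption | (symm; assumption)
  apply key <;> simp only [contact, Matrix.cons_val]
  · linear_combination -(p 0 ^ 2 * v 0 ^ 2 + ε * v 1 ^ 2) * hE
  · linear_combination (2 * p 1 * (p 0 ^ 2 * v 0 ^ 2 + ε * v 1 ^ 2) - 2 * p 0 ^ 3 * v 0 * v 1) * hE
  · linear_combination 2 * p 0 * v 0 * v 1 * hE
  · linear_combination (2 * p 0 ^ 3 * v 0 * v 1 * p 1 - p 0 ^ 4 * v 1 ^ 2
      - p 1 ^ 2 * (p 0 ^ 2 * v 0 ^ 2 + ε * v 1 ^ 2)) * hE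
  · linear_combination (p 0 ^ 2 * v 1 ^ 2 - 2 * p 0 * v 0 * v 1 * p 1) * hE
  · linear_combination (2 * p 0 * v 0 * v 1 * p 1 ^ 2 - 2 * p 0 ^ 2 * v 1 ^ 2 * p 1) * hE

theorem exists_conic_of_equation {a b : ℝ} {c : ℝ → Plane} {U : Set Plane}
    (hU : ∀ p ∈ U, p 0 ≠ 0) (hc : IsRegularArc U a b c)
    (h : ∀ t ∈ Set.Ioo a b,
      c t 0 ^ 3 * (deriv (deriv c) t 0 * deriv c t 1 - deriv (deriv c) t 1 * deriv c t 0)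
        + ε * deriv c t 1 ^ 3 = 0) :
    ∃ X ∈ quadric ε, ∀ t ∈ Set.Ioo a b, c t ∈ conic X := by
  obtain ⟨t₀, ht₀⟩ := Set.nonempty_Ioo.2 hc.lt
  have h0 := contact_ne_zero ε (hU _ (hc.mem t₀ ht₀)) (hc.deriv_ne_zero t₀ ht₀)
  refine ⟨Projectivization.mk ℝ _ h0, (mem_quadric_mk h0).2 (contact_quadric _ _ _),
    fun t ht => (mem_conic_mk h0).2 ?_⟩
  obtain ⟨r, -, hr⟩ := contact_const hU hc h ht₀ ht
  have := contact_conic ε (c t) (deriv c t)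
  rw [hr]
  simp only [Pi.smul_apply, smul_eq_mul]
  linear_combination r * this

theorem isGeodesicArc_iff_exists_conic (hg : IsMetricOn g U) (hn : IsNormalCoordinates g U ε)
    {a b : ℝ} {c : ℝ → Plane} (hc : IsRegularArc U a b c) :
    IsGeodesicArc g a b c ↔ ∃ X ∈ quadric ε, ∀ t ∈ Set.Ioo a b, c t ∈ conic X := by
  rw [isGeodesicArc_iff hg hn hc]
  refine ⟨exists_conic_of_equation hn.ne_zero hc, ?_⟩
  rintro ⟨X, hQ, hX⟩ t ht
  exact hc.equation_of_mem_conic hQ hX ht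

/-- Through every point of a conic of the quadric there is a regular arc of the conic. -/
theorem exists_arc_of_mem_conic (hU : ∀ p ∈ U, p 0 ≠ 0) {X : RP3} {p : Plane}
    (hp : p ∈ U) (hX : p ∈ conic X) : ∃ a b c, IsRegularArc U a b c ∧
      (∃ t ∈ Set.Ioo a b, c t = p) ∧ ∀ t ∈ Set.Ioo a b, c t ∈ conic X := by
  suffices h : ∃ (t₀ : ℝ) (c : ℝ → Plane), c t₀ = p ∧ ∀ᶠ t in nhds t₀, ContDiffAt ℝ 2 c t ∧
      deriv c t ≠ 0 ∧ c t ∈ conic X by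
    obtain ⟨t₀, c, h0, h⟩ := h
    have hcont : ContinuousAt c t₀ := h.self_of_nhds.1.continuousAt
    have hmem : ∀ᶠ t in nhds t₀, c t ∈ U := hcont.eventually (h0 ▸ U.isOpen.mem_nhds hp)
    obtain ⟨δ, hδ, hball⟩ := Metric.eventually_nhds_iff_ball.1 (h.and hmem)
    rw [Real.ball_eq_Ioo] at hball
    refine ⟨t₀ - δ, t₀ + δ, c, ⟨by linarith,
      fun t ht => (hball t ht).1.1.contDiffWithinAt, fun t ht => (hball t ht).2,
      fun t ht => (hball t ht).1.2.1⟩, ⟨t₀, ⟨by linarith, by linarith⟩, h0⟩,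
      fun t ht => (hball t ht).1.2.2⟩
  have hz := hU p hp
  have hC := conic_eq hX
  by_cases h3 : X.rep 3 = 0
  · refine ⟨p 0, fun t => ![t, p 1], funext fun i => by fin_cases i <;> rfl,
      Filter.Eventually.of_forall fun t => ⟨?_, ?_, ?_⟩⟩
    · refine contDiffAt_pi.2 fun i => ?_
      fin_cases i
      · exact contDiffAt_id
      · exact contDiffAt_const
    · have : HasDerivAt (fun t : ℝ => (![t, p 1] : Plane)) ![1, 0] t := by
        refine hasDerivAt_pi.2 fun i => ?_
        fin_cases i
        · exact hasDerivAt_id t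
        · exact hasDerivAt_const t _
      rw [this.deriv]
      exact fun h => one_ne_zero (congrFun h 0)
    · change X.rep 0 * p 1 ^ 2 + 2 * X.rep 1 * p 1 + X.rep 2 + X.rep 3 * t ^ 2 = 0
      rw [h3] at hC ⊢
      linear_combination hC
  -- The conic is z² = q(y), so y serves as parameter and z = ±√q with the sign of z at the given
  -- point; q > 0 nearby because z ≠ 0 there.
  · let q : ℝ → ℝ := fun t => -(X.rep 0 * t ^ 2 + 2 * X.rep 1 * t + X.rep 2) / X.rep 3
    have hq0 : q (p 1) = p 0 ^ 2 := by
      simp only [q]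
      rw [div_eq_iff h3]
      linear_combination -hC
    have hqs : ContDiff ℝ 2 q := by
      simp only [q]
      fun_prop
    let σ : ℝ := SignType.sign (p 0)
    have hpos : ∀ᶠ t in nhds (p 1), 0 < q t :=
      hqs.continuous.continuousAt.eventually (lt_mem_nhds (by rw [hq0]; positivity))
    have hσ : σ ^ 2 = 1 := by
      rcases lt_or_gt_of_ne hz with h | h <;> simp [σ, h]
    refine ⟨p 1, fun t => ![σ * √(q t), t], ?_, hpos.mono fun t ht => ⟨?_, ?_, ?_⟩⟩
    · funext i
      fin_cases i
      · change σ * √(q (p 1)) = p 0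
        rw [hq0, Real.sqrt_sq_eq_abs]
        exact sign_mul_abs _
      · rfl
    · refine contDiffAt_pi.2 fun i => ?_
      fin_cases i
      · exact contDiffAt_const.mul (hqs.contDiffAt.sqrt ht.ne')
      · exact contDiffAt_id
    · have hd : DifferentiableAt ℝ (fun t => (![σ * √(q t), t] : Plane)) t := by
        refine differentiableAt_pi.2 fun i => ?_
        fin_cases i
        · exact ((hqs.contDiffAt.sqrt ht.ne').differentiableAt two_ne_zero).const_mul σ
        · exact differentiableAt_id
      intro h
      have h1 := hasDerivAt_pi.1 hd.hasDerivAt 1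
      rw [h] at h1
      exact one_ne_zero ((hasDerivAt_id t).unique h1)
    · change X.rep 0 * t ^ 2 + 2 * X.rep 1 * t + X.rep 2 + X.rep 3 * (σ * √(q t)) ^ 2 = 0
      rw [mul_pow, hσ, Real.sq_sqrt ht.le]
      simp only [q]
      field_simp
      ring

end

section

/-! ### Foliations -/

variable {g : Plane → Matrix (Fin 2) (Fin 2) ℝ} {U : Opens Plane} {ε : ℝ}
  {L : Plane → Submodule ℝ Plane}

/-- An integral curve of a local spanning field, shortened so as to stay in the domain of the field.
-/
theorem IsFoliationOn.exists_leafArc (hL : IsFoliationOn L U) {p : Plane} (hp : p ∈ U) :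
    ∃ a b c, IsLeafArc L U a b c ∧ ∃ t ∈ Set.Ioo a b, c t = p := by
  obtain ⟨W, hW, hpW, hWU, X, hX, hXL⟩ := hL p hp
  have hX1 : ContDiffAt ℝ 1 X p := (hX.contDiffAt (hW.mem_nhds hpW)).of_le (by simp)
  obtain ⟨c, hc0, δ, hδ, hc⟩ :=
    hX1.exists_forall_mem_closedBall_exists_eq_forall_mem_Ioo_hasDerivAt₀ 0
  have hcont : ContinuousAt c 0 := (hc 0 ⟨by linarith, by linarith⟩).continuousAt
  have hmem : ∀ᶠ t in nhds (0 : ℝ), c t ∈ W := hcont.eventually (hc0 ▸ hW.mem_nhds hpW)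
  obtain ⟨η, hη, hball⟩ := Metric.eventually_nhds_iff_ball.1 hmem
  rw [Real.ball_eq_Ioo] at hball
  let θ := min δ η
  have hθ : 0 < θ := lt_min hδ hη
  have hθδ : θ ≤ δ := min_le_left _ _
  have hθη : θ ≤ η := min_le_right _ _
  have hd : ∀ t ∈ Set.Ioo (-θ) θ, HasDerivAt c (X (c t)) t := fun t ht =>
    hc t ⟨by linarith [ht.1], by linarith [ht.2]⟩
  have hm : ∀ t ∈ Set.Ioo (-θ) θ, c t ∈ W := fun t ht =>
    hball t ⟨by linarith [ht.1], by linarith [ht.2]⟩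
  have hdiff : DifferentiableOn ℝ c (Set.Ioo (-θ) θ) := fun t ht =>
    (hd t ht).differentiableAt.differentiableWithinAt
  have hder : ∀ t ∈ Set.Ioo (-θ) θ, deriv c t = X (c t) := fun t ht => (hd t ht).deriv
  -- Bootstrapping: the derivative of c is X ∘ c, so c is once more differentiable than already
  -- known.
  have h1 : ContDiffOn ℝ 1 c (Set.Ioo (-θ) θ) := by
    rw [show (1 : ℕ∞ω) = 0 + 1 from rfl, contDiffOn_succ_iff_deriv_of_isOpen isOpen_Ioo]
    refine ⟨hdiff, by simp, contDiffOn_zero.2 ?_⟩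
    exact (hX.continuousOn.comp hdiff.continuousOn hm).congr hder
  have h2 : ContDiffOn ℝ 2 c (Set.Ioo (-θ) θ) := by
    rw [show (2 : ℕ∞ω) = 1 + 1 from one_add_one_eq_two.symm,
      contDiffOn_succ_iff_deriv_of_isOpen isOpen_Ioo]
    refine ⟨hdiff, by simp, ?_⟩
    exact ((hX.of_le (by simp)).comp h1 hm).congr hder
  refine ⟨-θ, θ, c, ⟨⟨by linarith, h2, fun t ht => hWU (hm t ht), fun t ht => ?_⟩,
    fun t ht => ?_⟩, 0, ⟨by linarith, hθ⟩, hc0⟩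
  · rw [hder t ht]
    exact (hXL _ (hm t ht)).1
  · rw [hder t ht, (hXL _ (hm t ht)).2]
    exact Submodule.mem_span_singleton_self _

theorem IsFoliationOn.exists_eq_span (hL : IsFoliationOn L U) {p : Plane} (hp : p ∈ U) :
    ∃ x, x ≠ 0 ∧ L p = Submodule.span ℝ {x} := by
  obtain ⟨W, -, hpW, -, X, -, hX⟩ := hL p hp
  exact ⟨X p, hX p hpW⟩

theorem IsFoliationOn.eq_span_of_mem (hL : IsFoliationOn L U) {p : Plane} (hp : p ∈ U) {v : Plane}
    (hv : v ∈ L p) (hv0 : v ≠ 0) : L p = Submodule.span ℝ {v} := by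
  obtain ⟨x, -, h⟩ := hL.exists_eq_span hp
  rw [h] at hv ⊢
  obtain ⟨r, rfl⟩ := Submodule.mem_span_singleton.1 hv
  exact (Submodule.span_singleton_smul_eq (isUnit_iff_ne_zero.2 (left_ne_zero_of_smul hv0)) x).symm

/-- The dual focal curve lies in a plane if and only if so do all contact points. -/
theorem focalCurve_subset_plane_iff (hg : IsMetricOn g U) (hn : IsNormalCoordinates g U ε)
    (hL : IsFoliationOn L U) (hgeo : ∀ a b c, IsLeafArc L U a b c → IsGeodesicArc g a b c)
    (H : RP3) : focalCurve ε U L ⊆ plane H ↔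
      ∀ p ∈ U, ∀ v ∈ L p, ∑ i, H.rep i * contact ε p v i = 0 := by
  constructor
  · intro h p hp v hv
    obtain ⟨a, b, c, hc, t, ht, rfl⟩ := hL.exists_leafArc hp
    obtain ⟨X, hQ, hX⟩ := (isGeodesicArc_iff_exists_conic hg hn hc.regular).1 (hgeo a b c hc)
    obtain ⟨r, hr, hrep⟩ := hc.regular.rep_eq_smul_contact hn.ne_zero hQ hX ht
    have h1 := (mem_plane_iff hr hrep).1 (h ⟨hQ, a, b, c, hc, hX⟩)
    rw [hL.eq_span_of_mem hp (hc.tangent t ht) (hc.regular.deriv_ne_zero t ht)] at hv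
    obtain ⟨s, rfl⟩ := Submodule.mem_span_singleton.1 hv
    rw [contact_smul]
    simp only [Pi.smul_apply, smul_eq_mul, mul_left_comm _ (s ^ 2), ← Finset.mul_sum, h1, mul_zero]
  · rintro h X ⟨hQ, a, b, c, hc, hX⟩
    obtain ⟨t, ht⟩ := Set.nonempty_Ioo.2 hc.regular.lt
    obtain ⟨r, hr, hrep⟩ := hc.regular.rep_eq_smul_contact hn.ne_zero hQ hX ht
    exact (mem_plane_iff hr hrep).2 (h _ (hc.regular.mem t ht) _ (hc.tangent t ht))

theorem focalCurve_subset_quadric (U : Set Plane) (L : Plane → Submodule ℝ Plane) :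
    focalCurve ε U L ⊆ quadric ε := fun _ h => h.1

theorem exists_planeD_rep : ∃ r : ℝ, r ≠ 0 ∧ planeD.rep = r • ![0, 0, 0, 1] := by
  obtain ⟨a, ha⟩ := Projectivization.exists_smul_eq_mk_rep ℝ ![(0 : ℝ), 0, 0, 1]
    (fun h => one_ne_zero (congrFun h 3))
  exact ⟨a, a.ne_zero, ha.symm⟩

/-- The dual focal curve lies on the base conic if and only if the foliation is horizontal. -/
theorem focalCurve_subset_baseConic_iff (hg : IsMetricOn g U) (hn : IsNormalCoordinates g U ε)
    (hL : IsFoliationOn L U) (hgeo : ∀ a b c, IsLeafArc L U a b c → IsGeodesicArc g a b c) :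
    focalCurve ε U L ⊆ baseConic ε ↔ ∀ p ∈ U, ∀ v ∈ L p, v 1 = 0 := by
  rw [baseConic, Set.subset_inter_iff, and_iff_right (focalCurve_subset_quadric _ _),
    focalCurve_subset_plane_iff hg hn hL hgeo]
  obtain ⟨r, hr, h⟩ := exists_planeD_rep
  refine forall₂_congr fun p hp => forall₂_congr fun v hv => ?_
  have hz := hn.ne_zero p hp
  simp [h, Fin.sum_univ_four, contact, hr, hz]

/-- The slope `dz / dy` of a line that is not horizontal. -/
noncomputable def slope (M : Submodule ℝ Plane) : ℝ :=
  open Classical in if h : ∃ v ∈ M, v 1 ≠ 0 then h.choose 0 / h.choose 1 else 0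

theorem slope_span {x : Plane} (hx : x 1 ≠ 0) : slope (Submodule.span ℝ {x}) = x 0 / x 1 := by
  have h : ∃ v ∈ Submodule.span ℝ {x}, v 1 ≠ 0 := ⟨x, Submodule.mem_span_singleton_self x, hx⟩
  rw [slope, dif_pos h]
  obtain ⟨h1, h2⟩ := h.choose_spec
  obtain ⟨r, hr⟩ := Submodule.mem_span_singleton.1 h1
  rw [← hr] at h2 ⊢
  simp only [Pi.smul_apply, smul_eq_mul] at h2 ⊢
  exact mul_div_mul_left _ _ (left_ne_zero_of_mul h2)

theorem IsFoliationOn.eq_span_slope (hL : IsFoliationOn L U) {p : Plane} (hp : p ∈ U)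
    (h : ∃ v ∈ L p, v 1 ≠ 0) : L p = Submodule.span ℝ {![slope (L p), 1]} := by
  obtain ⟨v, hv, hv1⟩ := h
  have h0 := hL.eq_span_of_mem hp hv (fun h => hv1 (congrFun h 1))
  have hs : slope (L p) = v 0 / v 1 := by rw [h0, slope_span hv1]
  refine hL.eq_span_of_mem hp ?_ (fun h => one_ne_zero (congrFun h 1))
  have : ![slope (L p), 1] = (v 1)⁻¹ • v := by
    funext i
    fin_cases i
    · simp [hs, div_eq_inv_mul]
    · simp [hv1]
  rw [this]
  exact (L p).smul_mem _ hv

theorem IsFoliationOn.eq_span_horizontal (hL : IsFoliationOn L U) {p : Plane} (hp : p ∈ U)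
    (h : ¬∃ v ∈ L p, v 1 ≠ 0) : L p = Submodule.span ℝ {![1, 0]} := by
  push Not at h
  obtain ⟨x, hx0, hx⟩ := hL.exists_eq_span hp
  have hxL : x ∈ L p := hx ▸ Submodule.mem_span_singleton_self x
  have hx1 := h x hxL
  have hx2 : x 0 ≠ 0 := fun h => hx0 (funext fun i => by fin_cases i <;> assumption)
  refine hL.eq_span_of_mem hp ?_ (fun h => one_ne_zero (congrFun h 0))
  have : (![1, 0] : Plane) = (x 0)⁻¹ • x := by
    funext i
    fin_cases i <;> simp [hx1, hx2]
  rw [this]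
  exact (L p).smul_mem _ hxL

/-- Near a point where a foliation is not horizontal it is not horizontal and its slope is
smooth. -/
theorem IsFoliationOn.exists_contDiffOn_slope (hL : IsFoliationOn L U) {p : Plane} (hp : p ∈ U)
    (h : ∃ v ∈ L p, v 1 ≠ 0) : ∃ W : Set Plane, IsOpen W ∧ p ∈ W ∧ W ⊆ U ∧
      (∀ q ∈ W, ∃ v ∈ L q, v 1 ≠ 0) ∧ ContDiffOn ℝ ∞ (fun q => slope (L q)) W := by
  obtain ⟨W, hW, hpW, hWU, X, hX, hXL⟩ := hL p hp
  have hX' := contDiffOn_pi.1 hX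
  have hp1 : X p 1 ≠ 0 := by
    obtain ⟨v, hv, hv1⟩ := h
    rw [(hXL p hpW).2] at hv
    obtain ⟨r, rfl⟩ := Submodule.mem_span_singleton.1 hv
    exact right_ne_zero_of_mul hv1
  refine ⟨W ∩ (fun q => X q 1) ⁻¹' {0}ᶜ, (hX' 1).continuousOn.isOpen_inter_preimage hW
    isOpen_compl_singleton, ⟨hpW, hp1⟩, Set.inter_subset_left.trans hWU, ?_, ?_⟩
  · rintro q ⟨hq, hq1⟩
    refine ⟨X q, ?_, hq1⟩
    rw [(hXL q hq).2]
    exact Submodule.mem_span_singleton_self _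
  · refine ContDiffOn.congr (f := fun q => X q 0 / X q 1) ?_ ?_
    · exact ((hX' 0).mono Set.inter_subset_left).div ((hX' 1).mono Set.inter_subset_left)
        fun q hq => hq.2
    · rintro q ⟨hq, hq1⟩
      rw [(hXL q hq).2, slope_span hq1]

/-- The open set where a foliation is not horizontal. -/
def nonhorizontal (hL : IsFoliationOn L U) : Opens Plane where
  carrier := {p | p ∈ U ∧ ∃ v ∈ L p, v 1 ≠ 0}
  is_open' := by
    refine isOpen_iff_mem_nhds.2 fun p hp => ?_
    obtain ⟨W, hW, hpW, hWU, hv, -⟩ := hL.exists_contDiffOn_slope hp.1 hp.2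
    exact Filter.mem_of_superset (hW.mem_nhds hpW) fun q hq => ⟨hWU hq, hv q hq⟩

theorem contDiffOn_slope (hL : IsFoliationOn L U) :
    ContDiffOn ℝ ∞ (fun q => slope (L q)) (nonhorizontal hL) := by
  intro p hp
  obtain ⟨W, hW, hpW, -, -, h⟩ := hL.exists_contDiffOn_slope hp.1 hp.2
  exact (h.contDiffAt (hW.mem_nhds hpW)).contDiffWithinAt

theorem fderiv_apply_eq (F : Plane → ℝ) (p v : Plane) :
    fderiv ℝ F p v = v 0 * pd 0 F p + v 1 * pd 1 F p := by
  have : v = v 0 • Pi.single 0 1 + v 1 • Pi.single 1 1 := by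
    funext i
    fin_cases i <;> simp
  conv_lhs => rw [this]
  simp [pd]

/-- The equation of geodesics for the slope of a foliation by geodesics. -/
theorem pd_slope (hg : IsMetricOn g U) (hn : IsNormalCoordinates g U ε)
    (hL : IsFoliationOn L U) (hgeo : ∀ a b c, IsLeafArc L U a b c → IsGeodesicArc g a b c)
    {p : Plane} (hp : p ∈ nonhorizontal hL) :
    p 0 ^ 3 * (pd 1 (fun q => slope (L q)) p + slope (L p) * pd 0 (fun q => slope (L q)) p)
      + ε = 0 := by
  obtain ⟨a, b, c, hc, t, ht, rfl⟩ := hL.exists_leafArc hp.1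
  have hE := (isGeodesicArc_iff hg hn hc.regular).1 (hgeo a b c hc) t ht
  have h0 := hc.regular.hasDerivAt_deriv ht 0
  have h1 := hc.regular.hasDerivAt_deriv ht 1
  have hcd : HasDerivAt c (deriv c t) t := hasDerivAt_pi.2 fun i => hc.regular.hasDerivAt ht i
  have hσ := ((contDiffOn_slope hL).differentiableAt_opens hp).hasFDerivAt.comp_hasDerivAt t hcd
  have hslope : ∀ s ∈ Set.Ioo a b, c s ∈ nonhorizontal hL →
      deriv c s 0 = slope (L (c s)) * deriv c s 1 := by
    intro s hs hs'
    have hm := hc.tangent s hs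
    rw [hL.eq_span_slope hs'.1 hs'.2] at hm
    obtain ⟨r, hr⟩ := Submodule.mem_span_singleton.1 hm
    rw [← hr]
    simp [mul_comm]
  have hev : (fun s => deriv c s 0) =ᶠ[nhds t] fun s => slope (L (c s)) * deriv c s 1 := by
    filter_upwards [isOpen_Ioo.mem_nhds ht,
      hcd.continuousAt.eventually ((nonhorizontal hL).isOpen.mem_nhds hp)] with s hs hs'
    exact hslope s hs hs'
  have h2 := h0.unique ((hσ.mul h1).congr_of_eventuallyEq hev)
  rw [fderiv_apply_eq] at h2
  have hs := hslope t ht hp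
  have hv := hc.regular.deriv_ne_zero t ht
  simp only [Function.comp_apply] at h2
  generalize slope (L (c t)) = σ at *
  generalize deriv (deriv c) t = α at *
  generalize deriv c t = v at *
  generalize c t = p at *
  have hv1 : v 1 ≠ 0 := fun h => hv (funext fun i => by
    fin_cases i
    · simpa [h] using hs
    · exact h)
  -- With v₀ = σ v₁ and its derivative along the leaf inserted, v₁³ factors out of the geodesic
  -- equation.
  refine (mul_eq_zero.1 (?_ : v 1 ^ 3 * _ = 0)).resolve_left (pow_ne_zero 3 hv1)
  rw [hs] at h2 hE
  rw [h2] at hE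
  linear_combination hE

end

section

/-! ### Hexagonal geodesic webs -/

variable {g : Plane → Matrix (Fin 2) (Fin 2) ℝ} {U W : Opens Plane} {ε : ℝ}

theorem smoothFunctions_mul_cancel {f h : smoothFunctions W} (hh : ∀ q : W, h.1 q ≠ 0)
    (hfh : f * h = 0) : f = 0 :=
  Subtype.ext (funext fun q =>
    (mul_eq_zero.1 (congrFun (congrArg Subtype.val hfh) q)).resolve_right (hh q))

/-- The inverse of the first coordinate. -/
noncomputable def invCoord (hW : ∀ p ∈ W, p 0 ≠ 0) : smoothFunctions W :=
  restrict (fun q => (q 0)⁻¹) ((contDiffOn_coord_fun 0 W).inv hW)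

theorem invCoord_mul (hW : ∀ p ∈ W, p 0 ≠ 0) : invCoord hW * coord W 0 = 1 :=
  Subtype.ext (funext fun q => inv_mul_cancel₀ (hW q q.2))

section Slope

variable {L : Plane → Submodule ℝ Plane}

/-- The slope of a foliation on a subset where the foliation is not horizontal. -/
noncomputable def slopeOn (hL : IsFoliationOn L U) (hW : W ≤ nonhorizontal hL) :
    smoothFunctions W :=
  restrict (fun q => slope (L q)) ((contDiffOn_slope hL).mono hW)

theorem pdDerivation_slopeOn (hg : IsMetricOn g U) (hn : IsNormalCoordinates g U ε)
    (hL : IsFoliationOn L U) (hgeo : ∀ a b c, IsLeafArc L U a b c → IsGeodesicArc g a b c)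
    (hW : W ≤ nonhorizontal hL) (hz : ∀ p ∈ W, p 0 ≠ 0) :
    pdDerivation W 1 (slopeOn hL hW) = -algebraMap ℝ _ ε * invCoord hz ^ 3
      - slopeOn hL hW * pdDerivation W 0 (slopeOn hL hW) := by
  rw [slopeOn, pdDerivation_restrict, pdDerivation_restrict]
  refine Subtype.ext (funext fun q => ?_)
  have h := pd_slope hg hn hL hgeo (hW q.2)
  have hq := hz q q.2
  change pd 1 (fun q => slope (L q)) q = -ε * (q.1 0)⁻¹ ^ 3
    - slope (L q) * pd 0 (fun q => slope (L q)) q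
  field_simp
  linear_combination h

/-- A function constant along the leaves, on a set where the foliation is not horizontal. -/
theorem pdDerivation_one_of_constant (hL : IsFoliationOn L U) (hW : W ≤ nonhorizontal hL)
    {u : Plane → ℝ} (hu : ContDiffOn ℝ ∞ u W) (h : ∀ q ∈ W, ∀ v ∈ L q, fderiv ℝ u q v = 0) :
    pdDerivation W 1 (restrict u hu) = -(slopeOn hL hW * pdDerivation W 0 (restrict u hu)) := by
  rw [slopeOn, pdDerivation_restrict, pdDerivation_restrict]
  refine Subtype.ext (funext fun q => ?_)
  have h1 := h q q.2 _ ((hL.eq_span_slope (hW q.2).1 (hW q.2).2).ge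
    (Submodule.mem_span_singleton_self _))
  rw [fderiv_apply_eq] at h1
  change pd 1 u q = -(slope (L q) * pd 0 u q)
  simp only [Matrix.cons_val] at h1
  linear_combination h1

theorem pd_zero_ne_zero_of_constant (hL : IsFoliationOn L U) (hW : W ≤ nonhorizontal hL)
    {u : Plane → ℝ} (hu : ContDiffOn ℝ ∞ u W) (h : ∀ q ∈ W, ∀ v ∈ L q, fderiv ℝ u q v = 0)
    {q : Plane} (hq : q ∈ W) (h0 : fderiv ℝ u q ≠ 0) : pd 0 u q ≠ 0 := by
  intro hz
  have h1 := restrict_eq_iff.1 ((pdDerivation_restrict hu 1).symm.trans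
    ((pdDerivation_one_of_constant hL hW hu h).trans (by
      rw [slopeOn, pdDerivation_restrict, restrict_mul, restrict_neg]))) q hq
  rw [hz, mul_zero, neg_zero] at h1
  refine h0 (ContinuousLinearMap.ext fun v => ?_)
  rw [fderiv_apply_eq, hz, h1]
  simp

end Slope

variable {L : Fin 3 → Plane → Submodule ℝ Plane}

theorem IsGeodesicThreeWeb.slope_ne (hL : IsGeodesicThreeWeb g U L) {i j : Fin 3} (hij : i ≠ j)
    {p : Plane} (hi : p ∈ nonhorizontal (hL.foliation i))
    (hj : p ∈ nonhorizontal (hL.foliation j)) : slope (L i p) ≠ slope (L j p) := by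
  intro h
  refine hL.transverse p hi.1 i j hij ?_
  rw [(hL.foliation i).eq_span_slope hi.1 hi.2, (hL.foliation j).eq_span_slope hj.1 hj.2, h]

/-- Transversality: there is only one horizontal line at a point. -/
theorem IsGeodesicThreeWeb.nonhorizontal_of_ne (hL : IsGeodesicThreeWeb g U L) {i j : Fin 3}
    (hij : j ≠ i) {p : Plane} (hp : p ∈ U) (hi : ¬∃ v ∈ L i p, v 1 ≠ 0) :
    p ∈ nonhorizontal (hL.foliation j) := by
  by_contra hj
  refine hL.transverse p hp j i hij ?_
  rw [(hL.foliation i).eq_span_horizontal hp hi,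
    (hL.foliation j).eq_span_horizontal hp fun h => hj ⟨hp, h⟩]

theorem exists_others (i : Fin 3) : ∃ j k : Fin 3, j ≠ i ∧ k ≠ i ∧ j ≠ k ∧
    (∀ l, l = i ∨ l = j ∨ l = k) ∧ ∀ f : Fin 3 → ℝ, f 0 + f 1 + f 2 = f i + f j + f k := by
  fin_cases i
  · exact ⟨1, 2, by decide, by decide, by decide, by decide, fun f => rfl⟩
  · exact ⟨0, 2, by decide, by decide, by decide, by decide, fun f => by simp; ring⟩
  · exact ⟨0, 1, by decide, by decide, by decide, by decide, fun f => by simp; ring⟩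

/-- One of the foliations of a hexagonal web is horizontal at a given point. -/
theorem IsHexagonal.exists_horizontal_at (hg : IsMetricOn g U) (hε : ε ^ 2 = 1)
    (hn : IsNormalCoordinates g U ε) (hL : IsGeodesicThreeWeb g U L) (hhex : IsHexagonal U L)
    {p : Plane} (hp : p ∈ U) : ∃ i, ¬∃ v ∈ L i p, v 1 ≠ 0 := by
  by_contra! hnon
  obtain ⟨W', hW', hpW', hWU', u, hu, hdu, hsum⟩ := hhex p hp
  let W : Opens Plane := ⟨W', hW'⟩ ⊓ (nonhorizontal (hL.foliation 0) ⊓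
    (nonhorizontal (hL.foliation 1) ⊓ nonhorizontal (hL.foliation 2)))
  have hW : ∀ i, W ≤ nonhorizontal (hL.foliation i) := by
    intro i q hq
    fin_cases i
    exacts [hq.2.1, hq.2.2.1, hq.2.2.2]
  have hpW : p ∈ W := ⟨hpW', ⟨hp, hnon 0⟩, ⟨hp, hnon 1⟩, ⟨hp, hnon 2⟩⟩
  have : Nontrivial (smoothFunctions W) :=
    ⟨0, 1, fun h => zero_ne_one (congrFun (congrArg Subtype.val h) ⟨p, hpW⟩)⟩
  have hz : ∀ q ∈ W, q 0 ≠ 0 := fun q hq => hn.ne_zero q (hWU' hq.1)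
  have huW : ∀ i, ContDiffOn ℝ ∞ (u i) W := fun i => (hu i).mono fun q hq => hq.1
  have hconst : ∀ i, ∀ q ∈ W, ∀ v ∈ L i q, fderiv ℝ (u i) q v = 0 :=
    fun i q hq => (hdu i q hq.1).2
  let σ : Fin 3 → smoothFunctions W := fun i => slopeOn (hL.foliation i) (hW i)
  let υ : Fin 3 → smoothFunctions W := fun i => restrict (u i) (huW i)
  have hσ : ∀ i, _ := fun i =>
    pdDerivation_slopeOn hg hn (hL.foliation i) (hL.geodesic i) (hW i) hz
  have hυ : ∀ i, _ := fun i =>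
    pdDerivation_one_of_constant (hL.foliation i) (hW i) (huW i) (hconst i)
  change ∀ i, pdDerivation W 1 (υ i) = -(σ i * pdDerivation W 0 (υ i)) at hυ
  have hυ0 : υ 0 + υ 1 + υ 2 = 0 :=
    Subtype.ext (funext fun q => hsum q q.2.1)
  have hcomm := pdDerivation_comm (W := W) 0 1
  have ha : ∀ i, pdDerivation W 1 (pdDerivation W 0 (υ i))
      = -pdDerivation W 0 (σ i * pdDerivation W 0 (υ i)) := by
    intro i
    rw [← hcomm, hυ i, map_neg]
  have h0 := congrArg (pdDerivation W 0) hυ0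
  have h1 := congrArg (pdDerivation W 1) hυ0
  simp only [map_add, map_zero] at h0 h1
  rw [hυ 0, hυ 1, hυ 2] at h1
  have hS := smoothFunctions_mul_cancel ?_ (dz_dz_add_add hcomm (hσ 0) (hσ 1) (hσ 2) h0
    (by linear_combination -h1) (ha 0) (ha 1) (ha 2))
  · refine not_dz_dz_add_add hcomm ?_ ?_ (invCoord_mul hz) (ε := algebraMap ℝ _ ε) ?_
      (Derivation.map_algebraMap _ _) (Derivation.map_algebraMap _ _) (hσ 0) (hσ 1) (hσ 2) hS
    · simp [pdDerivation_coord]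
    · simp [pdDerivation_coord]
    · rw [← map_pow, hε, map_one]
  · intro q
    have e0 : pd 0 (u 0) q ≠ 0 := pd_zero_ne_zero_of_constant (hL.foliation 0) (hW 0) (huW 0)
      (hconst 0) q.2 (hdu 0 q q.2.1).1
    have e1 := hL.slope_ne (show (0 : Fin 3) ≠ 1 by decide) (hW 0 q.2) (hW 1 q.2)
    have e2 := hL.slope_ne (show (2 : Fin 3) ≠ 0 by decide) (hW 2 q.2) (hW 0 q.2)
    have e3 := pdDerivation_restrict (huW 0) 0
    change (pdDerivation W 0 (restrict (u 0) (huW 0))).1 q * (slope (L 0 q) - slope (L 1 q))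
      * (slope (L 2 q) - slope (L 0 q)) ≠ 0
    rw [e3]
    exact mul_ne_zero (mul_ne_zero e0 (sub_ne_zero.2 e1)) (sub_ne_zero.2 e2)

/-- One of the foliations of a hexagonal web is horizontal. -/
theorem IsHexagonal.exists_horizontal (hg : IsMetricOn g U) (hU : IsConnected (U : Set Plane))
    (hε : ε ^ 2 = 1) (hn : IsNormalCoordinates g U ε) (hL : IsGeodesicThreeWeb g U L)
    (hhex : IsHexagonal U L) : ∃ i, ∀ p ∈ U, ¬∃ v ∈ L i p, v 1 ≠ 0 := by
  obtain ⟨p₀, hp₀⟩ := hU.nonempty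
  obtain ⟨i, hi⟩ := hhex.exists_horizontal_at hg hε hn hL hp₀
  obtain ⟨j, k, hji, hki, hjk, hall, -⟩ := exists_others i
  refine ⟨i, fun p hp hv => ?_⟩
  -- At each point of U either foliation i is not horizontal, or both others are not. These two
  -- conditions are open; if both occurred, connectedness would give a point with three finite
  -- slopes.
  let A := nonhorizontal (hL.foliation i)
  let B := nonhorizontal (hL.foliation j) ⊓ nonhorizontal (hL.foliation k)
  have hcover : (U : Set Plane) ⊆ A ∪ B := by
    intro q hq
    by_cases hqi : ∃ v ∈ L i q, v 1 ≠ 0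
    · exact Or.inl ⟨hq, hqi⟩
    · exact Or.inr ⟨hL.nonhorizontal_of_ne hji hq hqi, hL.nonhorizontal_of_ne hki hq hqi⟩
  obtain ⟨q, hqU, hqA, hqB⟩ := hU.isPreconnected A B A.isOpen B.isOpen hcover
    ⟨p, hp, hp, hv⟩ ⟨p₀, hp₀, hL.nonhorizontal_of_ne hji hp₀ hi,
      hL.nonhorizontal_of_ne hki hp₀ hi⟩
  obtain ⟨l, hl⟩ := hhex.exists_horizontal_at hg hε hn hL hqU
  rcases hall l with rfl | rfl | rfl
  · exact hl hqA.2
  · exact hl hqB.1.2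
  · exact hl hqB.2.2

/-- The function `u i` has zero z-derivative, so those of `u j` and `u k` are opposite and
`dz_dz_add` applies with one common a. The local functions serve only near each point; the
conclusion concerns the globally defined slopes. -/
theorem IsHexagonal.pd_pd_slope_add (hg : IsMetricOn g U) (hn : IsNormalCoordinates g U ε)
    (hL : IsGeodesicThreeWeb g U L) (hhex : IsHexagonal U L) {i j k : Fin 3} (hjk : j ≠ k)
    (hsum3 : ∀ f : Fin 3 → ℝ, f 0 + f 1 + f 2 = f i + f j + f k)
    (hi : ∀ p ∈ U, ¬∃ v ∈ L i p, v 1 ≠ 0) (hj : U ≤ nonhorizontal (hL.foliation j))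
    (hk : U ≤ nonhorizontal (hL.foliation k)) :
    pdDerivation U 0 (pdDerivation U 0 (slopeOn (hL.foliation j) hj + slopeOn (hL.foliation k) hk))
      = 0 := by
  simp only [slopeOn, restrict_add, pdDerivation_restrict]
  refine Subtype.ext (funext fun p => ?_)
  obtain ⟨W', hW', hpW', hWU', u, hu, hdu, hsum⟩ := hhex p p.2
  let W : Opens Plane := ⟨W', hW'⟩
  have hjW : W ≤ nonhorizontal (hL.foliation j) := fun q hq => hj (hWU' hq)
  have hkW : W ≤ nonhorizontal (hL.foliation k) := fun q hq => hk (hWU' hq)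
  have hz : ∀ q ∈ W, q 0 ≠ 0 := fun q hq => hn.ne_zero q (hWU' hq)
  let υ : Fin 3 → smoothFunctions W := fun i => restrict (u i) (hu i)
  have hυ0 : υ i + υ j + υ k = 0 := Subtype.ext (funext fun q =>
    (hsum3 fun i => u i q).symm.trans (hsum q q.2))
  have hυi : pdDerivation W 0 (υ i) = 0 := by
    simp only [υ, pdDerivation_restrict]
    refine Subtype.ext (funext fun q => ?_)
    have hq := (hL.foliation i).eq_span_horizontal (hWU' q.2) (hi q (hWU' q.2))
    have := (hdu i q q.2).2 ![1, 0] (hq ▸ Submodule.mem_span_singleton_self _)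
    rw [fderiv_apply_eq] at this
    simp only [Matrix.cons_val] at this
    change pd 0 (u i) q = 0
    linear_combination this
  have hυj : pdDerivation W 1 (υ j) = _ := pdDerivation_one_of_constant (hL.foliation j) hjW (hu j)
    fun q hq => (hdu j q hq).2
  have hυk : pdDerivation W 1 (υ k) = _ := pdDerivation_one_of_constant (hL.foliation k) hkW (hu k)
    fun q hq => (hdu k q hq).2
  have h0 := congrArg (pdDerivation W 0) hυ0
  simp only [map_add, map_zero, hυi, zero_add] at h0
  have hcomm := pdDerivation_comm (W := W) 0 1
  have ha := congrArg (pdDerivation W 0) hυj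
  have hb := congrArg (pdDerivation W 0) hυk
  change _ = pdDerivation W 0 (-(_ * pdDerivation W 0 (υ j))) at ha
  change _ = pdDerivation W 0 (-(_ * pdDerivation W 0 (υ k))) at hb
  rw [eq_neg_of_add_eq_zero_right h0] at hb
  rw [hcomm, map_neg] at ha hb
  have hneg : slopeOn (hL.foliation k) hkW * -pdDerivation W 0 (υ j)
      = -(slopeOn (hL.foliation k) hkW * pdDerivation W 0 (υ j)) := by ring
  rw [eq_neg_of_add_eq_zero_right h0, map_neg, hneg, map_neg, neg_inj] at hb
  have hS := smoothFunctions_mul_cancel ?_ (dz_dz_add hcomm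
    (pdDerivation_slopeOn hg hn (hL.foliation j) (hL.geodesic j) hjW hz)
    (pdDerivation_slopeOn hg hn (hL.foliation k) (hL.geodesic k) hkW hz) ha hb)
  · simp only [slopeOn, restrict_add, pdDerivation_restrict] at hS
    exact congrFun (congrArg Subtype.val hS) ⟨p, hpW'⟩
  · intro q
    have e0 : pd 0 (u j) q ≠ 0 := pd_zero_ne_zero_of_constant (hL.foliation j) hjW (hu j)
      (fun q hq => (hdu j q hq).2) q.2 (hdu j q q.2).1
    have e1 := hL.slope_ne hjk (hjW q.2) (hkW q.2)
    have e3 := pdDerivation_restrict (W := W) (hu j) 0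
    change (pdDerivation W 0 (restrict (u j) (hu j))).1 q * (slope (L j q) - slope (L k q)) ≠ 0
    rw [e3]
    exact mul_ne_zero e0 (sub_ne_zero.2 e1)

/-- The two other foliations of a hexagonal web with a horizontal foliation are cut out by
a plane. -/
theorem IsHexagonal.exists_plane (hg : IsMetricOn g U) (hU : IsConnected (U : Set Plane))
    (hε : ε ^ 2 = 1) (hn : IsNormalCoordinates g U ε)
    (hL : IsGeodesicThreeWeb g U L) (hhex : IsHexagonal U L) {i j k : Fin 3} (hjk : j ≠ k)
    (hsum3 : ∀ f : Fin 3 → ℝ, f 0 + f 1 + f 2 = f i + f j + f k)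
    (hi : ∀ p ∈ U, ¬∃ v ∈ L i p, v 1 ≠ 0) (hj : U ≤ nonhorizontal (hL.foliation j))
    (hk : U ≤ nonhorizontal (hL.foliation k)) :
    ∃ H : RP3, H ≠ planeD ∧ (∀ p ∈ U, ∀ v ∈ L j p, ∑ i, H.rep i * contact ε p v i = 0) ∧
      ∀ p ∈ U, ∀ v ∈ L k p, ∑ i, H.rep i * contact ε p v i = 0 := by
  have hcomm := pdDerivation_comm (W := U) 0 1
  obtain ⟨κ, α, β, γ, δ, ⟨hα0, hβ0, hγ0, hδ0⟩, ⟨hα1, hβ1, hγ1, hδ1⟩, hq, hs, hπ⟩ :=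
    exists_plane_of_dz_dz_add hcomm (y := coord U 1) (by simp [pdDerivation_coord])
    (by simp [pdDerivation_coord]) (by simp [pdDerivation_coord]) (by simp [pdDerivation_coord])
    (invCoord_mul hn.ne_zero) (ε := algebraMap ℝ _ ε) (by rw [← map_pow, hε, map_one])
    (Derivation.map_algebraMap _ _) (Derivation.map_algebraMap _ _)
    (pdDerivation_slopeOn hg hn (hL.foliation j) (hL.geodesic j) hj hn.ne_zero)
    (pdDerivation_slopeOn hg hn (hL.foliation k) (hL.geodesic k) hk hn.ne_zero)
    (hhex.pd_pd_slope_add hg hn hL hjk hsum3 hi hj hk)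
  -- Since f_z = 0 and f_y = -κ f, the direction of f is constant on the connected set U, so its
  -- value at any one point defines the plane.
  let f : Fin 4 → smoothFunctions U := ![α, β, γ, δ]
  have hf0 : ∀ m, pdDerivation U 0 (f m) = 0 := by
    intro m; fin_cases m <;> assumption
  have hf1 : ∀ m, pdDerivation U 1 (f m) = -κ * f m := by
    intro m; fin_cases m <;> assumption
  choose F hF hfF using fun m => exists_eq_restrict (f m)
  obtain ⟨K, hK, hκ⟩ := exists_eq_restrict κ
  have hF0 : ∀ m, ∀ p ∈ U, pd 0 (F m) p = 0 := by
    intro m p hp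
    have := hf0 m
    rw [hfF, pdDerivation_restrict] at this
    exact congrFun (congrArg Subtype.val this) ⟨p, hp⟩
  have hF1 : ∀ m, ∀ p ∈ U, pd 1 (F m) p = -K p * F m p := by
    intro m p hp
    have := hf1 m
    rw [hfF, pdDerivation_restrict, hκ] at this
    exact congrFun (congrArg Subtype.val this) ⟨p, hp⟩
  have eα : α = restrict (F 0) (hF 0) := hfF 0
  have eβ : β = restrict (F 1) (hF 1) := hfF 1
  have eγ : γ = restrict (F 2) (hF 2) := hfF 2
  have eδ : δ = restrict (F 3) (hF 3) := hfF 3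
  rw [eα, eβ, eγ] at hq
  rw [eβ, eγ] at hs
  rw [eγ, eδ] at hπ
  have hq' : ∀ p ∈ U, F 0 p - F 1 p * p 1 + F 2 p * p 1 ^ 2 = 1 := fun p hp =>
    congrFun (congrArg Subtype.val hq) ⟨p, hp⟩
  have hs' : ∀ p ∈ U, slope (L j p) + slope (L k p) = (-F 1 p + 2 * F 2 p * p 1) * p 0 :=
    fun p hp => congrFun (congrArg Subtype.val hs) ⟨p, hp⟩
  have hπ' : ∀ p ∈ U, slope (L j p) * slope (L k p)
      = F 2 p * p 0 ^ 2 - ε * (p 0)⁻¹ ^ 2 - F 3 p :=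
    fun p hp => congrFun (congrArg Subtype.val hπ) ⟨p, hp⟩
  have hne : ∀ p ∈ U, (fun m => F m p) ≠ 0 := by
    intro p hp h
    have h' : ∀ m, F m p = 0 := congrFun h
    have := hq' p hp
    rw [h', h', h'] at this
    simp at this
  obtain ⟨p₀, hp₀⟩ := hU.nonempty
  obtain ⟨a, ha⟩ := Projectivization.exists_smul_eq_mk_rep ℝ _ (hne p₀ hp₀)
  have hprop : ∀ p ∈ U, ∃ r : ℝ, ∀ m,
      (Projectivization.mk ℝ _ (hne p₀ hp₀)).rep m = r * F m p := by
    intro p hp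
    obtain ⟨r, -, hr⟩ := exists_eq_smul_of_hasFDerivAt (x := fun p m => F m p) U.isOpen
      hU.isPreconnected (fun p hp m => ((hF m).differentiableAt_opens hp).hasFDerivAt) hne (by
        intro p hp m n
        refine ContinuousLinearMap.ext fun v => ?_
        simp only [smul_apply, smul_eq_mul, fderiv_apply_eq, hF0 _ p hp, hF1 _ p hp]
        ring) hp₀ hp
    refine ⟨a * r, fun m => ?_⟩
    rw [← ha, hr, mul_assoc]
    rfl
  have hquad : ∀ p ∈ U, ∀ σ : ℝ, (σ - slope (L j p)) * (σ - slope (L k p)) = 0 →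
      ∑ m, F m p * contact ε p ![σ, 1] m = 0 := by
    intro p hp σ h
    have h1 := hq' p hp
    have h2 := hs' p hp
    have h3 := hπ' p hp
    have hz := hn.ne_zero p hp
    have h4 : (p 0)⁻¹ ^ 2 * p 0 ^ 2 = 1 := by field_simp
    simp only [Fin.sum_univ_four, contact, Matrix.cons_val]
    linear_combination (p 0 ^ 2 * σ ^ 2 - ε) * h1 + p 0 ^ 2 * σ * h2 - p 0 ^ 2 * h3
      + p 0 ^ 2 * h + ε * h4
  have hfinal : ∀ l, l = j ∨ l = k → ∀ p ∈ U, ∀ v ∈ L l p,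
      ∑ m, (Projectivization.mk ℝ _ (hne p₀ hp₀)).rep m * contact ε p v m = 0 := by
    intro l hl p hp v hv
    have hlp : p ∈ nonhorizontal (hL.foliation l) := by
      rcases hl with rfl | rfl
      exacts [hj hp, hk hp]
    obtain ⟨r, hr⟩ := hprop p hp
    have hσ := hquad p hp (slope (L l p)) (by rcases hl with rfl | rfl <;> ring)
    rw [(hL.foliation l).eq_span_slope hlp.1 hlp.2] at hv
    obtain ⟨s, rfl⟩ := Submodule.mem_span_singleton.1 hv
    rw [contact_smul]
    calc _ = r * s ^ 2 * ∑ m, F m p * contact ε p ![slope (L l p), 1] m := by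
          rw [Finset.mul_sum]
          refine Finset.sum_congr rfl fun m _ => ?_
          rw [hr, Pi.smul_apply, smul_eq_mul]
          ring
      _ = 0 := by rw [hσ, mul_zero]
  refine ⟨_, fun hD => ?_, hfinal j (Or.inl rfl), hfinal k (Or.inr rfl)⟩
  -- For the plane D = 0 the first three coordinates would vanish, against F₀ - F₁y + F₂y² = 1.
  obtain ⟨r, hr, hDr⟩ := exists_planeD_rep
  rw [← hD, ← ha] at hDr
  have hm : ∀ m, (a : ℝ) * F m p₀ = r * ![0, 0, 0, (1 : ℝ)] m := fun m => congrFun hDr m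
  have h0 : F 0 p₀ = 0 := by simpa using hm 0
  have h1 : F 1 p₀ = 0 := by simpa using hm 1
  have h2 : F 2 p₀ = 0 := by simpa using hm 2
  have := hq' p₀ hp₀
  rw [h0, h1, h2] at this
  simp at this

end

section

/-! ### Webs cut out by a plane -/

/-- Integrability of the normalized web form, for two families of geodesics whose slopes have
the sum `z * dy Q / Q`. -/
theorem dy_eq_neg_dz_mul {R : Type*} [CommRing R] [Algebra ℝ R] {dz dy : Derivation ℝ R R}
    (hcomm : ∀ f, dz (dy f) = dy (dz f)) {z φ p q Q F : R} (hz : dz z = 1)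
    (hp : dy p = φ - p * dz p) (hq : dy q = φ - q * dz q) (hQ : dz Q = 0)
    (hs : (p + q) * Q = dy Q * z) (hF : F * (Q * (p - q)) = 1) :
    dy F = -dz (p * F) ∧ dy F = -dz (q * F) := by
  have hQ' : dz (dy Q) = 0 := by rw [hcomm, hQ, map_zero]
  have h1 := congrArg dz hs
  have h2 := congrArg dz hF
  have h3 := congrArg dy hF
  simp only [Derivation.leibniz, smul_eq_mul, Derivation.map_one_eq_zero, map_sub, map_add, hQ,
    hQ', hz, hp, hq] at h1 h2 h3
  -- Indeed F(p - q) = 1/Q depends on y only.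
  have h4 : dz (p * F) = dz (q * F) := by
    simp only [Derivation.leibniz, smul_eq_mul]
    linear_combination F * (p - q) * h2 - (dz F * (p - q) + F * (dz p - dz q)) * hF
  have h5 : dy F = -dz (p * F) := by
    simp only [Derivation.leibniz, smul_eq_mul]
    linear_combination F * (h3 + p * h2 + F * (p - q) * h1)
      - (dy F + p * dz F + F * dz p) * hF
  exact ⟨h5, h5.trans (by rw [h4])⟩

/-- The Poincaré lemma in the plane. -/
theorem exists_primitive {B : Opens Plane} (hB : Convex ℝ (B : Set Plane)) {F G : Plane → ℝ}
    (hF : ContDiffOn ℝ ∞ F B) (hG : ContDiffOn ℝ ∞ G B) (h : ∀ q ∈ B, pd 1 F q = pd 0 G q) :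
    ∃ u : Plane → ℝ, ContDiffOn ℝ ∞ u B ∧
      ∀ q ∈ B, ∀ v, fderiv ℝ u q v = F q * v 0 + G q * v 1 := by
  let η : Plane → Plane →L[ℝ] ℝ := fun q =>
    F q • ContinuousLinearMap.proj 0 + G q • ContinuousLinearMap.proj 1
  have hη : ContDiffOn ℝ ∞ η B := (hF.smul contDiffOn_const).add (hG.smul contDiffOn_const)
  have hηd : ∀ q ∈ B, ∀ x y, fderiv ℝ η q x y = fderiv ℝ F q x * y 0 + fderiv ℝ G q x * y 1 := by
    intro q hq x y
    have h1 := ((hF.differentiableAt_opens hq).hasFDerivAt.smul_const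
      (ContinuousLinearMap.proj (R := ℝ) (φ := fun _ : Fin 2 => ℝ) 0)).add
      ((hG.differentiableAt_opens hq).hasFDerivAt.smul_const
      (ContinuousLinearMap.proj (R := ℝ) (φ := fun _ : Fin 2 => ℝ) 1))
    have h2 : fderiv ℝ η q = _ := h1.fderiv
    rw [h2]
    simp
  obtain ⟨u, hu⟩ := hB.exists_forall_hasFDerivAt_of_fderiv_symmetric B.isOpen
    (hη.differentiableOn (by simp)) (fun q hq x y => by
      simp only [hηd q hq, fderiv_apply_eq, h q hq]
      ring)
  refine ⟨u, (contDiffOn_infty_iff_fderiv_of_isOpen B.isOpen).2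
    ⟨fun q hq => (hu q hq).differentiableAt.differentiableWithinAt,
      hη.congr fun q hq => (hu q hq).fderiv⟩, fun q hq v => ?_⟩
  rw [(hu q hq).fderiv]
  simp [η]

variable {g : Plane → Matrix (Fin 2) (Fin 2) ℝ} {U : Opens Plane} {ε : ℝ}
  {L : Fin 3 → Plane → Submodule ℝ Plane}

/-- A nonzero plane section does not contain two families of transverse geodesics through
the points of a horizontal line on which its leading coefficient vanishes. -/
theorem leading_coeff_ne_zero {H : Fin 4 → ℝ} (hH : H ≠ 0) {s t : Plane → ℝ}
    (hz : ∀ p ∈ U, p 0 ≠ 0) (hst : ∀ p ∈ U, s p ≠ t p)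
    (hs : ∀ p ∈ U, ∑ m, H m * contact ε p ![s p, 1] m = 0)
    (ht : ∀ p ∈ U, ∑ m, H m * contact ε p ![t p, 1] m = 0) {p : Plane} (hp : p ∈ U) :
    H 0 - H 1 * p 1 + H 2 * p 1 ^ 2 ≠ 0 := by
  intro h0
  have key : ∀ p ∈ U, H 0 - H 1 * p 1 + H 2 * p 1 ^ 2 = 0 →
      -H 1 + 2 * H 2 * p 1 = 0 ∧ H 2 * p 0 ^ 2 = H 3 := by
    intro p hp h0
    have h1 := hs p hp
    have h2 := ht p hp
    have hz := hz p hp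
    have hst := sub_ne_zero.2 (hst p hp)
    simp only [Fin.sum_univ_four, contact, Matrix.cons_val] at h1 h2
    -- Without its quadratic term the plane equation is affine in the slope and has two distinct
    -- roots, so its other coefficients vanish too.
    have h3 : -H 1 + 2 * H 2 * p 1 = 0 := by
      refine (mul_eq_zero.1 (?_ : p 0 ^ 3 * (s p - t p) * _ = 0)).resolve_left
        (mul_ne_zero (pow_ne_zero 3 hz) hst)
      linear_combination h2 - h1 + (p 0 ^ 2 * (s p ^ 2 - t p ^ 2)) * h0
    refine ⟨h3, mul_left_cancel₀ (pow_ne_zero 2 hz) ?_⟩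
    linear_combination h1 - (p 0 ^ 2 * s p ^ 2 - ε) * h0 + p 0 ^ 3 * s p * h3
  have hcont : Continuous fun τ : ℝ => (![p 0 + τ, p 1] : Plane) := by
    refine continuous_pi fun i => ?_
    fin_cases i
    · exact continuous_const.add continuous_id
    · exact continuous_const
  have hp0 : (![p 0 + 0, p 1] : Plane) = p := by
    funext i
    fin_cases i <;> simp
  have hev : ∀ᶠ τ in nhds (0 : ℝ), (![p 0 + τ, p 1] : Plane) ∈ U :=
    hcont.continuousAt.eventually (by
      change (U : Set Plane) ∈ nhds (![p 0 + 0, p 1] : Plane)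
      rw [hp0]
      exact U.isOpen.mem_nhds hp)
  obtain ⟨δ, hδ, hball⟩ := Metric.eventually_nhds_iff_ball.1 hev
  rw [Real.ball_eq_Ioo] at hball
  obtain ⟨h1, h3⟩ := key p hp h0
  -- Along the horizontal line y, and hence the vanishing leading coefficient, does not change. So
  -- H₂z² = H₃ holds for z ± δ/2, and subtraction gives 2zδ H₂ = 0.
  have a1 := (key _ (hball (δ / 2) ⟨by linarith, by linarith⟩) (by simpa using h0)).2
  have a2 := (key _ (hball (-(δ / 2)) ⟨by linarith, by linarith⟩) (by simpa using h0)).2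
  simp only [Matrix.cons_val] at a1 a2
  have e2 : H 2 = 0 := by
    refine (mul_eq_zero.1 (?_ : (2 * p 0 * δ) * _ = 0)).resolve_left
      (mul_ne_zero (mul_ne_zero two_ne_zero (hz p hp)) hδ.ne')
    linear_combination a1 - a2
  have e3 : H 3 = 0 := by rw [← h3, e2, zero_mul]
  have e1 : H 1 = 0 := by rw [e2] at h1; linear_combination -h1
  have e0 : H 0 = 0 := by rw [e1, e2] at h0; linear_combination h0
  exact hH (funext fun m => by fin_cases m <;> assumption)

/-- Both F(dz - p dy) and F(dz - q dy) are closed by `dy_eq_neg_dz_mul`, whose hypothesis on p + q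
is Vieta's formula for the plane equation. -/
theorem isHexagonal_of_plane (hg : IsMetricOn g U) (hn : IsNormalCoordinates g U ε)
    (hL : IsGeodesicThreeWeb g U L) {i j k : Fin 3} (hji : j ≠ i) (hki : k ≠ i) (hjk : j ≠ k)
    (hall : ∀ l, l = i ∨ l = j ∨ l = k)
    (hsum3 : ∀ f : Fin 3 → ℝ, f 0 + f 1 + f 2 = f i + f j + f k)
    (hi : ∀ p ∈ U, ∀ v ∈ L i p, v 1 = 0) {H : Fin 4 → ℝ} (hH : H ≠ 0)
    (hHj : ∀ p ∈ U, ∀ v ∈ L j p, ∑ m, H m * contact ε p v m = 0)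
    (hHk : ∀ p ∈ U, ∀ v ∈ L k p, ∑ m, H m * contact ε p v m = 0) : IsHexagonal U L := by
  have hi' : ∀ p ∈ U, ¬∃ v ∈ L i p, v 1 ≠ 0 := fun p hp ⟨v, hv, hv1⟩ => hv1 (hi p hp v hv)
  have hj : U ≤ nonhorizontal (hL.foliation j) := fun p hp =>
    hL.nonhorizontal_of_ne hji hp (hi' p hp)
  have hk : U ≤ nonhorizontal (hL.foliation k) := fun p hp =>
    hL.nonhorizontal_of_ne hki hp (hi' p hp)
  have hspan : ∀ l, l = j ∨ l = k → ∀ p ∈ U,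
      L l p = Submodule.span ℝ {![slope (L l p), 1]} := by
    intro l hl p hp
    rcases hl with rfl | rfl
    · exact (hL.foliation _).eq_span_slope hp (hj hp).2
    · exact (hL.foliation _).eq_span_slope hp (hk hp).2
  have hst : ∀ p ∈ U, slope (L j p) ≠ slope (L k p) := fun p hp =>
    hL.slope_ne hjk (hj hp) (hk hp)
  have hs := fun p hp => hHj p hp _
    ((hspan j (Or.inl rfl) p hp).ge (Submodule.mem_span_singleton_self _))
  have ht := fun p hp => hHk p hp _
    ((hspan k (Or.inr rfl) p hp).ge (Submodule.mem_span_singleton_self _))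
  let Q : Plane → ℝ := fun p => H 0 - H 1 * p 1 + H 2 * p 1 ^ 2
  have hQ : ∀ p ∈ U, Q p ≠ 0 := fun p hp => leading_coeff_ne_zero hH hn.ne_zero hst hs ht hp
  let Qf : smoothFunctions U := algebraMap ℝ _ (H 0) - algebraMap ℝ _ (H 1) * coord U 1
    + algebraMap ℝ _ (H 2) * coord U 1 ^ 2
  have hdQ : pdDerivation U 1 Qf
      = -algebraMap ℝ _ (H 1) + 2 * algebraMap ℝ _ (H 2) * coord U 1 := by
    simp only [Qf, map_add, map_sub, Derivation.leibniz, Derivation.leibniz_pow, pdDerivation_coord,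
      Derivation.map_algebraMap, smul_eq_mul, if_true, nsmul_eq_mul]
    push_cast
    ring
  have hFs : ContDiffOn ℝ ∞ (fun p => (Q p * (slope (L j p) - slope (L k p)))⁻¹) U := by
    refine ContDiffOn.inv (ContDiffOn.mul ?_ (((contDiffOn_slope (hL.foliation j)).mono hj).sub
      ((contDiffOn_slope (hL.foliation k)).mono hk))) fun p hp =>
        mul_ne_zero (hQ p hp) (sub_ne_zero.2 (hst p hp))
    have := contDiffOn_coord_fun 1 (U : Set Plane)
    exact (contDiffOn_const.sub (contDiffOn_const.mul this)).add (contDiffOn_const.mul (this.pow 2))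
  obtain ⟨hFj, hFk⟩ := dy_eq_neg_dz_mul (pdDerivation_comm (W := U) 0 1) (Q := Qf)
    (z := coord U 0) (F := restrict _ hFs) (by simp [pdDerivation_coord])
    (pdDerivation_slopeOn hg hn (hL.foliation j) (hL.geodesic j) hj hn.ne_zero)
    (pdDerivation_slopeOn hg hn (hL.foliation k) (hL.geodesic k) hk hn.ne_zero)
    (by simp [Qf, Derivation.leibniz, Derivation.leibniz_pow, pdDerivation_coord])
    (by
      rw [hdQ]
      refine Subtype.ext (funext fun p => ?_)
      change (slope (L j p) + slope (L k p)) * (H 0 - H 1 * p.1 1 + H 2 * p.1 1 ^ 2)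
        = (-H 1 + 2 * H 2 * p.1 1) * p.1 0
      have h1 := hs p p.2
      have h2 := ht p p.2
      have hz := hn.ne_zero p p.2
      have h3 := sub_ne_zero.2 (hst p p.2)
      simp only [Fin.sum_univ_four, contact, Matrix.cons_val] at h1 h2
      refine mul_left_cancel₀ (mul_ne_zero (pow_ne_zero 2 hz) h3) ?_
      linear_combination h1 - h2)
    (Subtype.ext (funext fun p =>
      inv_mul_cancel₀ (mul_ne_zero (hQ p p.2) (sub_ne_zero.2 (hst p p.2)))))
  rw [slopeOn, restrict_mul, pdDerivation_restrict, pdDerivation_restrict, restrict_neg,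
    restrict_eq_iff] at hFj hFk
  intro p hp
  obtain ⟨δ, hδ, hball⟩ := Metric.isOpen_iff.1 U.isOpen p hp
  let B : Opens Plane := ⟨Metric.ball p δ, Metric.isOpen_ball⟩
  have hBU : ∀ q ∈ B, q ∈ U := hball
  set F : Plane → ℝ := fun p => (Q p * (slope (L j p) - slope (L k p)))⁻¹ with hF
  have hF0 : ∀ q ∈ U, F q ≠ 0 := fun q hq =>
    inv_ne_zero (mul_ne_zero (hQ q hq) (sub_ne_zero.2 (hst q hq)))
  have hσj := (contDiffOn_slope (hL.foliation j)).mono hj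
  have hσk := (contDiffOn_slope (hL.foliation k)).mono hk
  have hpdneg : ∀ {f : Plane → ℝ} {q}, pd 0 (fun q => -f q) q = -pd 0 f q := by
    intro f q
    rw [pd, fderiv_fun_neg]
    rfl
  obtain ⟨u, hu, hdu⟩ := exists_primitive (B := B) (convex_ball p δ)
    (F := F) (G := fun q => -(slope (L j q) * F q)) (hFs.mono hBU) ((hσj.mul hFs).neg.mono hBU)
    fun q hq => by rw [hpdneg]; exact hFj q (hBU q hq)
  obtain ⟨w, hw, hdw⟩ := exists_primitive (B := B) (convex_ball p δ)
    (F := F) (G := fun q => -(slope (L k q) * F q)) (hFs.mono hBU) ((hσk.mul hFs).neg.mono hBU)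
    fun q hq => by rw [hpdneg]; exact hFk q (hBU q hq)
  -- With du = F(dz - p dy) and dw = F(dz - q dy), the difference w - u has differential F(p - q)
  -- dy, which vanishes on horizontal lines; u, -w and w - u add up to zero.
  let υ : Fin 3 → Plane → ℝ := fun l => if l = j then u else if l = k then fun q => -w q
    else fun q => w q - u q
  have υj : υ j = u := if_pos rfl
  have υk : υ k = fun q => -w q := by simp [υ, hjk.symm]
  have υi : υ i = fun q => w q - u q := by simp [υ, hji.symm, hki.symm]
  refine ⟨B, B.isOpen, Metric.mem_ball_self hδ, hBU, υ, fun l => ?_, fun l q hq => ?_,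
    fun q hq => ?_⟩
  · rcases hall l with rfl | rfl | rfl
    · rw [υi]; exact hw.sub hu
    · rw [υj]; exact hu
    · rw [υk]; exact hw.neg
  · have hqU := hBU q hq
    rcases hall l with rfl | rfl | rfl
    · have hd : ∀ v, fderiv ℝ (υ l) q v
          = F q * (slope (L j q) - slope (L k q)) * v 1 := by
        intro v
        rw [υi, fderiv_fun_sub (hw.differentiableAt_opens hq) (hu.differentiableAt_opens hq),
          sub_apply, hdu q hq, hdw q hq]
        ring
      refine ⟨fun h => ?_, fun v hv => ?_⟩
      · have := hd ![0, 1]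
        rw [h] at this
        simp [hF0 q hqU, sub_ne_zero.2 (hst q hqU)] at this
      · rw [hd, hi q hqU v hv, mul_zero]
    · rw [υj]
      refine ⟨fun h => ?_, fun v hv => ?_⟩
      · have := hdu q hq ![1, 0]
        rw [h] at this
        refine hF0 q hqU ?_
        simpa using this.symm
      · rw [hspan l (Or.inl rfl) q hqU] at hv
        obtain ⟨r, rfl⟩ := Submodule.mem_span_singleton.1 hv
        rw [hdu q hq]
        simp
        ring
    · have hd : ∀ v, fderiv ℝ (υ l) q v = -(F q * v 0 + -(slope (L l q) * F q) * v 1) := by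
        intro v
        rw [υk, fderiv_fun_neg, neg_apply, hdw q hq]
      refine ⟨fun h => ?_, fun v hv => ?_⟩
      · have := hd ![1, 0]
        rw [h] at this
        simp [hF0 q hqU] at this
      · rw [hspan l (Or.inr rfl) q hqU] at hv
        obtain ⟨r, rfl⟩ := Submodule.mem_span_singleton.1 hv
        rw [hd]
        simp
        ring
  · have := hsum3 fun l => υ l q
    simp only [υi, υj, υk] at this
    rw [this]
    ring

end

end GeodesicWeb

/-! ### The main theorem. -/

open GeodesicWeb in
theorem mainTheorem3 (ε : ℝ) (hε : ε = 1 ∨ ε = -1)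
    (U : TopologicalSpace.Opens Plane) (hU : IsConnected (U : Set Plane))
    (g : Plane → Matrix (Fin 2) (Fin 2) ℝ) (hg : IsMetricOn g U)
    (hdim : Module.finrank ℝ (projectiveAlgebra g U) = 3)
    (hnormal : IsNormalCoordinates g U ε) :
    (∀ a b c, IsRegularArc U a b c →
      (IsGeodesicArc g a b c ↔ ∃ X ∈ quadric ε, ∀ t ∈ Set.Ioo a b, c t ∈ conic X)) ∧
    (∀ a b c, IsRegularArc U a b c → ∀ X ∈ quadric ε, ∀ Y ∈ quadric ε,
      (∀ t ∈ Set.Ioo a b, c t ∈ conic X) → (∀ t ∈ Set.Ioo a b, c t ∈ conic Y) → X = Y) ∧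
    (∀ X ∈ quadric ε, ∀ p ∈ U, p ∈ conic X → ∃ a b c, IsRegularArc U a b c ∧
      IsGeodesicArc g a b c ∧ (∃ t ∈ Set.Ioo a b, c t = p) ∧
      ∀ t ∈ Set.Ioo a b, c t ∈ conic X) ∧
    (∀ L : Fin 3 → Plane → Submodule ℝ Plane, IsGeodesicThreeWeb g U L →
      (IsHexagonal U L ↔
        ∃ i, focalCurve ε U (L i) ⊆ baseConic ε ∧
          ∃ H : RP3, H ≠ planeD ∧
            ∀ j, j ≠ i → focalCurve ε U (L j) ⊆ quadric ε ∩ plane H)) := by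
  have hε2 : ε ^ 2 = 1 := by rcases hε with rfl | rfl <;> norm_num
  refine ⟨fun a b c hc => isGeodesicArc_iff_exists_conic hg hnormal hc,
    fun a b c hc X hX Y hY => hc.eq_of_mem_conic hnormal.ne_zero hX hY, ?_, ?_⟩
  · intro X hX p hp hpX
    obtain ⟨a, b, c, hc, hcp, hcX⟩ := exists_arc_of_mem_conic hnormal.ne_zero hp hpX
    exact ⟨a, b, c, hc, (isGeodesicArc_iff_exists_conic hg hnormal hc).2 ⟨X, hX, hcX⟩, hcp, hcX⟩
  · intro L hL
    have hbase := fun i => focalCurve_subset_baseConic_iff hg hnormal (hL.foliation i)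
      (hL.geodesic i)
    have hplane := fun i => focalCurve_subset_plane_iff hg hnormal (hL.foliation i)
      (hL.geodesic i)
    constructor
    · intro hhex
      obtain ⟨i, hi⟩ := hhex.exists_horizontal hg hU hε2 hnormal hL
      obtain ⟨j, k, hji, hki, hjk, hall, hsum⟩ := exists_others i
      obtain ⟨H, hH, hHj, hHk⟩ := hhex.exists_plane hg hU hε2 hnormal hL hjk hsum hi
        (fun p hp => hL.nonhorizontal_of_ne hji hp (hi p hp))
        (fun p hp => hL.nonhorizontal_of_ne hki hp (hi p hp))
      refine ⟨i, (hbase i).2 fun p hp v hv => by_contra fun h => hi p hp ⟨v, hv, h⟩, H, hH,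
        fun l hl => Set.subset_inter (focalCurve_subset_quadric _ _) ((hplane l H).2 ?_)⟩
      rcases hall l with rfl | rfl | rfl
      · exact absurd rfl hl
      · exact hHj
      · exact hHk
    · rintro ⟨i, hi, H, -, hH⟩
      obtain ⟨j, k, hji, hki, hjk, hall, hsum⟩ := exists_others i
      exact isHexagonal_of_plane hg hnormal hL hji hki hjk hall hsum ((hbase i).1 hi)
        H.rep_nonzero ((hplane j H).1 ((hH j hji).trans Set.inter_subset_right))
        ((hplane k H).1 ((hH k hki).trans Set.inter_subset_right))
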